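/- Let $E$ be a separable real Banach space with norm $|\cdot|$, and let ${\rm UC}_{\rm b}$ be the set of bounded uniformly continuous functions $E\to\mathbb{R}$ with the pointwise order. Let $c\colon E\to[0,\infty]$ be convex with $c(0)=0$ and $\lim_{|a|\to\infty}c(a)/|a|=\infty$. Let $(\Omega,\mathcal F,(\mathcal F_t)_{t\ge0},\mathbb P)$ be a filtered probability space (no completeness or right-continuity is assumed) and $(Y_t)_{t\ge0}$ an $E$-valued Lévy process on it: $Y$ is adapted, $Y_0=0$ a.s., $Y_t-Y_s$ is independent of $\mathcal F_s$ for $s\le t$, $Y_{s+t}-Y_s$ has the same law as $Y_t$ for all $s,t\ge 0$, and $Y$ is continuous in probability. Let $\mu_t$ be the law of $Y_t$ for $t>0$. For $f\in{\rm UC}_{\rm b}$, $x\in E$ and $t>0$ put \[ (\Phi_tf)(x)=\sup_{a\in E}\big(f(x+a)-t\,c(a/t)\big),\qquad (\mu_tf)(x)=\int_E f(x+y)\,\mu_t(dy), \] \[ I_tf=\mu_t\Phi_tf,\qquad J_tf=\Phi_t\mu_tf, \] and $\Phi_0f=I_0f=J_0f=f$. Let $\mathcal A$ be the set of all adapted,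 jointly measurable processes $\alpha\colon[0,\infty)\times\Omega\to E$ with $\int_0^t|\alpha_u|\,du<\infty$ for all $t\ge0$, $\mathbb P$-a.s., and for $t\ge 0$ put \[ (V_tf)(x)=\sup_{\alpha\in\mathcal A}\mathbb E\Big[f\Big(x+Y_t+\int_0^t\alpha_u\,du\Big)-\int_0^tc(\alpha_u)\,du\Big], \] where the expectation is $-\infty$ if $\mathbb E\big[\int_0^tc(\alpha_u)\,du\big]=\infty$ (if $c$ is not Borel measurable, the integrals of $c(\alpha_u)$ are understood as lower integrals). All these operators map ${\rm UC}_{\rm b}$ to itself. Then, for all $s,t\ge0$ and $f\in{\rm UC}_{\rm b}$, \[ \Phi_{s+t}f=\Phi_s\Phi_tf,\qquad J_{s+t}f\le J_sJ_tf,\qquad I_{s+t}f\ge I_sI_tf,\qquad V_{s+t}f=V_sV_tf . \] -/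

import Mathlib

open MeasureTheory ProbabilityTheory Filter Topology Bornology
open scoped NNReal ENNReal BoundedContinuousFunction

noncomputable section

namespace HopfLax

/-- The space `UC_b` of bounded uniformly continuous functions `E → ℝ`. It inherits the pointwise
order and the supremum distance from `E →ᵇ ℝ`. -/
abbrev UCb (E : Type*) [PseudoMetricSpace E] : Type _ := {f : E →ᵇ ℝ // UniformContinuous f}

instance {E : Type*} [PseudoMetricSpace E] : CoeFun (UCb E) (fun _ => E → ℝ) := ⟨fun f => f.1⟩

/-- A function that is bounded and uniformly continuous, as an element of `UC_b`. -/
def UCb.mk {E : Type*} [PseudoMetricSpace E] (f : E → ℝ)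
    (hf : UniformContinuous f ∧ ∃ C : ℝ, ∀ x, |f x| ≤ C) : UCb E :=
  ⟨BoundedContinuousFunction.ofNormedAddCommGroup f hf.1.continuous hf.2.choose
    hf.2.choose_spec, hf.1⟩

@[simp] theorem UCb.mk_apply {E : Type*} [PseudoMetricSpace E] (f : E → ℝ)
    (hf : UniformContinuous f ∧ ∃ C : ℝ, ∀ x, |f x| ≤ C) (x : E) : UCb.mk f hf x = f x := rfl

/-! ### A criterion for suprema to define elements of `UC_b` -/

section Sup

variable {E : Type*} [PseudoMetricSpace E] {ι : Type*} {g : ι → E → ℝ} {κ : ι → ℝ≥0∞} {C : ℝ}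

theorem sup_bounds (hC : ∀ i x, |g i x| ≤ C) (hκ : ∃ i, κ i = 0) (x : E) :
    ((-C : ℝ) : EReal) ≤ ⨆ i, ((g i x : EReal) - (κ i : EReal)) ∧
      (⨆ i, ((g i x : EReal) - (κ i : EReal))) ≤ (C : EReal) := by
  constructor
  · obtain ⟨i, hi⟩ := hκ
    refine le_trans ?_ (le_iSup _ i)
    rw [hi]
    rw [EReal.coe_ennreal_zero, sub_zero, EReal.coe_le_coe_iff]
    exact (abs_le.1 (hC i x)).1
  · refine iSup_le fun i => ?_
    calc (g i x : EReal) - (κ i : EReal) ≤ (C : EReal) - 0 :=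
          EReal.sub_le_sub (EReal.coe_le_coe_iff.2 (abs_le.1 (hC i x)).2) (EReal.coe_ennreal_nonneg _)
      _ = C := by simp

theorem coe_toReal_sup (hC : ∀ i x, |g i x| ≤ C) (hκ : ∃ i, κ i = 0) (x : E) :
    ((⨆ i, ((g i x : EReal) - (κ i : EReal))).toReal : EReal) =
      ⨆ i, ((g i x : EReal) - (κ i : EReal)) := by
  obtain ⟨h₁, h₂⟩ := sup_bounds hC hκ x
  exact EReal.coe_toReal (ne_top_of_le_ne_top (EReal.coe_ne_top C) h₂)
    (ne_bot_of_le_ne_bot (EReal.coe_ne_bot _) h₁)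

theorem sup_mem_UCb (hC : ∀ i x, |g i x| ≤ C) (hκ : ∃ i, κ i = 0)
    (hg : ∀ ε > 0, ∃ δ > 0, ∀ x y, dist x y < δ → ∀ i, |g i x - g i y| ≤ ε) :
    UniformContinuous (fun x => (⨆ i, ((g i x : EReal) - (κ i : EReal))).toReal) ∧
      ∃ B : ℝ, ∀ x, |(⨆ i, ((g i x : EReal) - (κ i : EReal))).toReal| ≤ B := by
  have key : ∀ (ε : ℝ) (x y : E), (∀ i, |g i x - g i y| ≤ ε) →
      (⨆ i, ((g i x : EReal) - (κ i : EReal))).toReal ≤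
        (⨆ i, ((g i y : EReal) - (κ i : EReal))).toReal + ε := by
    intro ε x y h
    rw [← EReal.coe_le_coe_iff, EReal.coe_add, coe_toReal_sup hC hκ, coe_toReal_sup hC hκ]
    refine iSup_le fun i => ?_
    calc (g i x : EReal) - (κ i : EReal) ≤ ((g i y + ε : ℝ) : EReal) - (κ i : EReal) := by
          refine EReal.sub_le_sub (EReal.coe_le_coe_iff.2 ?_) le_rfl
          linarith [(abs_le.1 (h i)).2]
      _ = ((g i y : EReal) - (κ i : EReal)) + (ε : EReal) := by
          rw [EReal.coe_add, sub_eq_add_neg, sub_eq_add_neg, add_right_comm]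
      _ ≤ _ := by gcongr; exact le_iSup (fun i => (g i y : EReal) - (κ i : EReal)) i
  refine ⟨?_, C, fun x => ?_⟩
  · rw [Metric.uniformContinuous_iff]
    intro ε hε
    obtain ⟨δ, hδ, h⟩ := hg (ε / 2) (half_pos hε)
    refine ⟨δ, hδ, fun {x y} hxy => ?_⟩
    have h₁ := key _ x y (h x y hxy)
    have h₂ := key _ y x (h y x (by rwa [dist_comm]))
    rw [Real.dist_eq]
    refine lt_of_le_of_lt (abs_le.2 ⟨?_, ?_⟩) (half_lt_self hε) <;> linarith
  · obtain ⟨h₁, h₂⟩ := sup_bounds hC hκ x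
    rw [← coe_toReal_sup hC hκ, EReal.coe_le_coe_iff] at h₁ h₂
    exact abs_le.2 ⟨h₁, h₂⟩

end Sup

section Basic

variable {E : Type*} [NormedAddCommGroup E]

theorem UCb.abs_le (f : UCb E) (x : E) : |f x| ≤ ‖f.1‖ := f.1.norm_coe_le_norm x

theorem UCb.exists_modulus (f : UCb E) (ε : ℝ) (hε : 0 < ε) :
    ∃ δ > 0, ∀ x y, dist x y < δ → ∀ z, |f (x + z) - f (y + z)| ≤ ε := by
  obtain ⟨δ, hδ, h⟩ := Metric.uniformContinuous_iff.1 f.2 ε hε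
  refine ⟨δ, hδ, fun x y hxy z => ?_⟩
  have := h (a := x + z) (b := y + z) (by simpa using hxy)
  rw [Real.dist_eq] at this
  exact this.le

theorem abs_integral_le {Ω : Type*} [MeasurableSpace Ω] (P : Measure Ω) [IsProbabilityMeasure P]
    (f : UCb E) (X : Ω → E) (x : E) : |∫ ω, f (x + X ω) ∂P| ≤ ‖f.1‖ := by
  have := norm_integral_le_of_norm_le_const (μ := P) (f := fun ω => f (x + X ω)) (C := ‖f.1‖)
    (ae_of_all _ fun ω => f.abs_le _)
  simpa using this

theorem abs_integral_sub_le {Ω : Type*} [MeasurableSpace Ω] (P : Measure Ω)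
    [IsProbabilityMeasure P] (f : UCb E) (X : Ω → E) (hX : AEStronglyMeasurable X P) (x y : E)
    (ε : ℝ) (h : ∀ z, |f (x + z) - f (y + z)| ≤ ε) :
    |∫ ω, f (x + X ω) ∂P - ∫ ω, f (y + X ω) ∂P| ≤ ε := by
  have hi : ∀ x : E, Integrable (fun ω => f (x + X ω)) P := fun x =>
    Integrable.of_bound (f.1.continuous.comp_aestronglyMeasurable (hX.const_add x)) ‖f.1‖
      (ae_of_all _ fun ω => f.abs_le _)
  rw [← integral_sub (hi x) (hi y)]
  have := norm_integral_le_of_norm_le_const (μ := P)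
    (f := fun ω => f (x + X ω) - f (y + X ω)) (C := ε) (ae_of_all _ fun ω => h _)
  simpa using this

end Basic

/-! ### Cost functions and the Hopf-Lax operators -/

/-- A convex function `c : E → [0, ∞]` with `c 0 = 0` and superlinear growth. -/
structure IsCost {E : Type*} [NormedAddCommGroup E] [NormedSpace ℝ E] (c : E → ℝ≥0∞) : Prop where
  convex : ConvexOn ℝ≥0 Set.univ c
  zero : c 0 = 0
  superlinear : Tendsto (fun a => c a / ‖a‖ₑ) (cobounded E) (𝓝 ∞)

section HopfLaxOperator

variable {E : Type*} [NormedAddCommGroup E] [NormedSpace ℝ E]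

/-- `sup_{a ∈ E} (f (x + a) - t c (a / t))`, as an extended real number (for `t > 0`). -/
def hopfLaxSup (c : E → ℝ≥0∞) (t : ℝ≥0) (f : E → ℝ) (x : E) : EReal :=
  ⨆ a : E, ((f (x + a) : EReal) - ((t * c (t⁻¹ • a) : ℝ≥0∞) : EReal))

/-- The supremum is finite. -/
theorem coe_toReal_hopfLaxSup {c : E → ℝ≥0∞} (hc : IsCost c) (t : ℝ≥0) (f : UCb E) (x : E) :
    ((hopfLaxSup c t f x).toReal : EReal) = hopfLaxSup c t f x :=
  coe_toReal_sup (g := fun (a x : E) => f (x + a)) (fun _ _ => f.abs_le _)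
    ⟨0, by simp [hc.zero]⟩ x

theorem hopfLaxSup_mem {c : E → ℝ≥0∞} (hc : IsCost c) (t : ℝ≥0) (f : UCb E) :
    UniformContinuous (fun x => (hopfLaxSup c t f x).toReal) ∧
      ∃ B : ℝ, ∀ x, |(hopfLaxSup c t f x).toReal| ≤ B :=
  sup_mem_UCb (g := fun (a x : E) => f (x + a)) (fun _ _ => f.abs_le _)
    ⟨0, by simp [hc.zero]⟩ f.exists_modulus

/-- The Hopf-Lax operator `Φ_t : UC_b → UC_b`, with `Φ_0 f = f`. -/
def Φ {c : E → ℝ≥0∞} (hc : IsCost c) (t : ℝ≥0) (f : UCb E) : UCb E :=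
  if t = 0 then f else UCb.mk (fun x => (hopfLaxSup c t f x).toReal) (hopfLaxSup_mem hc t f)

end HopfLaxOperator

section Compositions

variable {E : Type*} [NormedAddCommGroup E] [TopologicalSpace.SeparableSpace E]
  [MeasurableSpace E] [BorelSpace E]

theorem transition_mem (μ : ProbabilityMeasure E) (f : UCb E) :
    UniformContinuous (fun x => ∫ y, f (x + y) ∂(μ : Measure E)) ∧
      ∃ B : ℝ, ∀ x, |∫ y, f (x + y) ∂(μ : Measure E)| ≤ B := by
  have : SecondCountableTopology E := UniformSpace.secondCountable_of_separable E
  refine ⟨?_, ‖f.1‖, fun x => abs_integral_le _ f (fun y => y) x⟩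
  rw [Metric.uniformContinuous_iff]
  intro ε hε
  obtain ⟨δ, hδ, h⟩ := f.exists_modulus (ε / 2) (half_pos hε)
  refine ⟨δ, hδ, fun {x y} hxy => ?_⟩
  rw [Real.dist_eq]
  exact lt_of_le_of_lt (abs_integral_sub_le _ f (fun y => y)
    continuous_id.aestronglyMeasurable x y _ (h x y hxy)) (half_lt_self hε)

/-- The operator `(μ f)(x) = ∫ f (x + y) μ(dy)` on `UC_b`. -/
def transition (μ : ProbabilityMeasure E) (f : UCb E) : UCb E :=
  UCb.mk (fun x => ∫ y, f (x + y) ∂(μ : Measure E)) (transition_mem μ f)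

variable [NormedSpace ℝ E]

/-- `I_t f = μ_t Φ_t f`, with `I_0 f = f`. -/
def I {c : E → ℝ≥0∞} (hc : IsCost c) (μ : ℝ≥0 → ProbabilityMeasure E) (t : ℝ≥0) (f : UCb E) :
    UCb E :=
  if t = 0 then f else transition (μ t) (Φ hc t f)

/-- `J_t f = Φ_t μ_t f`, with `J_0 f = f`. -/
def J {c : E → ℝ≥0∞} (hc : IsCost c) (μ : ℝ≥0 → ProbabilityMeasure E) (t : ℝ≥0) (f : UCb E) :
    UCb E :=
  if t = 0 then f else Φ hc t (transition (μ t) f)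

end Compositions

/-! ### Lévy processes, admissible controls and the value function -/

section Control

variable {Ω : Type*} {m : MeasurableSpace Ω} {E : Type*} [NormedAddCommGroup E]

/-- `Y` is an `E`-valued Lévy process on the filtered probability space `(Ω, m, 𝓕, P)`: it is
adapted, starts at `0`, has stationary increments that are independent of the past, and is
continuous in probability. -/
structure IsLevyProcess [MeasurableSpace E] (𝓕 : Filtration ℝ≥0 m) (P : Measure Ω)
    (Y : ℝ≥0 → Ω → E) : Prop where
  adapted : StronglyAdapted 𝓕 Y
  zero : ∀ᵐ ω ∂P, Y 0 ω = 0
  indep : ∀ s t, s ≤ t → Indep (MeasurableSpace.comap (Y t - Y s) inferInstance) (𝓕 s) P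
  stationary : ∀ s t, IdentDistrib (Y (s + t) - Y s) (Y t) P P
  tendstoInMeasure : ∀ t, TendstoInMeasure P Y (𝓝 t) (Y t)

/-- The set `𝒜` of admissible controls: adapted (jointly measurable) processes with almost surely
locally integrable paths. Times `u ≥ 0` are embedded into `ℝ` for integration. -/
def admissible (𝓕 : Filtration ℝ≥0 m) (P : Measure Ω) : Set (ℝ≥0 → Ω → E) :=
  {α | StronglyAdapted 𝓕 α ∧ StronglyMeasurable (Function.uncurry α) ∧
    ∀ᵐ ω ∂P, ∀ t : ℝ≥0, IntegrableOn (fun u : ℝ => α u.toNNReal ω) (Set.Ioc 0 (t : ℝ))}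

variable [NormedSpace ℝ E]

/-- The controlled dynamics `Y_t^{x,α} = x + Y_t + ∫_0^t α_u du`; written as
`x + (Y_t + ∫_0^t α_u du)`. -/
def controlled (Y α : ℝ≥0 → Ω → E) (t : ℝ≥0) (x : E) (ω : Ω) : E :=
  x + (Y t ω + ∫ u in Set.Ioc 0 (t : ℝ), α u.toNNReal ω)

/-- The expected running cost `𝔼[∫_0^t c(α_u) du] ∈ [0, ∞]`. -/
def runningCost (c : E → ℝ≥0∞) (P : Measure Ω) (α : ℝ≥0 → Ω → E) (t : ℝ≥0) : ℝ≥0∞ :=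
  ∫⁻ ω, (∫⁻ u in Set.Ioc 0 (t : ℝ), c (α u.toNNReal ω)) ∂P

/-- `sup_{α ∈ 𝒜} 𝔼[f(Y_t^{x,α}) - ∫_0^t c(α_u) du]`. As `f` is bounded and `c ≥ 0`, the expectation
is the difference of `𝔼[f(Y_t^{x,α})] ∈ ℝ` and `𝔼[∫_0^t c(α_u) du] ∈ [0, ∞]`. -/
def valueSup (c : E → ℝ≥0∞) (𝓕 : Filtration ℝ≥0 m) (P : Measure Ω) (Y : ℝ≥0 → Ω → E) (t : ℝ≥0)
    (f : E → ℝ) (x : E) : EReal :=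
  ⨆ α : admissible (E := E) 𝓕 P,
    (((∫ ω, f (controlled Y α t x ω) ∂P : ℝ) : EReal) - (runningCost c P α t : EReal))

theorem exists_runningCost_eq_zero {c : E → ℝ≥0∞} (hc : IsCost c) (𝓕 : Filtration ℝ≥0 m)
    (P : Measure Ω) (t : ℝ≥0) :
    ∃ α : admissible (E := E) 𝓕 P, runningCost c P α t = 0 :=
  ⟨⟨fun _ _ => 0, fun _ => stronglyMeasurable_const, stronglyMeasurable_const, by simp⟩,
    by simp [runningCost, hc.zero]⟩

/-- The supremum is finite. -/
theorem coe_toReal_valueSup {c : E → ℝ≥0∞} (hc : IsCost c) (𝓕 : Filtration ℝ≥0 m) (P : Measure Ω)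
    [IsProbabilityMeasure P] (Y : ℝ≥0 → Ω → E) (t : ℝ≥0) (f : UCb E) (x : E) :
    ((valueSup c 𝓕 P Y t f x).toReal : EReal) = valueSup c 𝓕 P Y t f x :=
  coe_toReal_sup
    (g := fun (α : admissible (E := E) 𝓕 P) (x : E) => ∫ ω, f (controlled Y α t x ω) ∂P)
    (fun _ x => abs_integral_le P f _ x) (exists_runningCost_eq_zero hc 𝓕 P t) x

theorem valueSup_mem [MeasurableSpace E] {c : E → ℝ≥0∞} (hc : IsCost c)
    {𝓕 : Filtration ℝ≥0 m} {P : Measure Ω} [IsProbabilityMeasure P] {Y : ℝ≥0 → Ω → E}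
    (hY : IsLevyProcess 𝓕 P Y) (t : ℝ≥0) (f : UCb E) :
    UniformContinuous (fun x => (valueSup c 𝓕 P Y t f x).toReal) ∧
      ∃ B : ℝ, ∀ x, |(valueSup c 𝓕 P Y t f x).toReal| ≤ B := by
  refine sup_mem_UCb
    (g := fun (α : admissible (E := E) 𝓕 P) (x : E) => ∫ ω, f (controlled Y α t x ω) ∂P)
    (fun _ x => abs_integral_le P f _ x) (exists_runningCost_eq_zero hc 𝓕 P t) ?_
  intro ε hε
  obtain ⟨δ, hδ, h⟩ := f.exists_modulus ε hε
  refine ⟨δ, hδ, fun x y hxy α => ?_⟩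
  refine abs_integral_sub_le P f _ ?_ x y ε (h x y hxy)
  refine (((hY.adapted t).mono (𝓕.le t)).add ?_).aestronglyMeasurable
  have h₁ : StronglyMeasurable (fun p : Ω × ℝ => (α : ℝ≥0 → Ω → E) p.2.toNNReal p.1) :=
    α.2.2.1.comp_measurable ((measurable_real_toNNReal.comp measurable_snd).prodMk measurable_fst)
  exact h₁.integral_prod_right

/-- The value function `V_t : UC_b → UC_b` of the drift control problem. -/
def V [MeasurableSpace E] {c : E → ℝ≥0∞} (hc : IsCost c)
    {𝓕 : Filtration ℝ≥0 m} {P : Measure Ω} [IsProbabilityMeasure P] {Y : ℝ≥0 → Ω → E}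
    (hY : IsLevyProcess 𝓕 P Y) (t : ℝ≥0) (f : UCb E) : UCb E :=
  UCb.mk (fun x => (valueSup c 𝓕 P Y t f x).toReal) (valueSup_mem hc hY t f)

end Control

end HopfLax

end

/-! Convexity of `c` lets two constant velocities be merged into their average at no extra cost,
which gives the semigroup law for Φ. A supremum of averages is at most the average of suprema, so
Φ_t μ_s ≤ μ_s Φ_t (`Φ_transition_le`). With μ_{s+t} = μ_s μ_t, this one exchange gives both
inequalities for I and J.

The dynamic programming principle is obtained without pasting controls on path space. For a step h >
0, knowing the coming noise increment can only help, and freezing the velocity can only hurt: V_r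
J_h^n f ≤ V_{r+nh} f ≤ V_r I_h^n f (`V_iterate_J_le`, `V_add_nsmul_le`). The words I_h^n = (μΦ)^n
and J_h^n = (Φμ)^n differ only at their two ends. All operators preserve translation moduli, so the
end corrections are small uniformly in n as h → 0 (`exists_iterate_I_le`). With nh = t, taking r = 0
squeezes V_t f between two functions at distance ε, and taking r = s squeezes V_{s+t} f between
their images under V_s.

The upper bound is a pathwise Jensen inequality, made available for nonmeasurable `c` by passing to
its closed hull. The lower bound uses a countably valued feedback velocity. Both need the controlled
state to have an 𝓕_s-measurable version, although controls are not assumed progressively measurable.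
-/

namespace HopfLax

/-! ### Monotone translation-compatible operators and swapping in iterates -/

section Equimonotone

variable {E : Type*} [NormedAddCommGroup E]

theorem UCb.ext {f g : UCb E} (h : ∀ x, f x = g x) : f = g :=
  Subtype.ext (BoundedContinuousFunction.ext h)

theorem UCb.integrable_comp {Ω : Type*} [MeasurableSpace Ω] (P : Measure Ω)
    [IsProbabilityMeasure P] (f : UCb E) {X : Ω → E} (hX : AEStronglyMeasurable X P) :
    Integrable (fun ω => f (X ω)) P :=
  Integrable.of_bound (f.1.continuous.comp_aestronglyMeasurable hX) ‖f.1‖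
    (ae_of_all _ fun _ => f.abs_le _)

/-- An operator that is monotone, commutes with translations and is subadditive for constants. -/
def IsEquimonotone (T : UCb E → UCb E) : Prop :=
  ∀ (f g : UCb E) (z : E) (r : ℝ), (∀ x, f (x + z) ≤ g x + r) → ∀ x, T f (x + z) ≤ T g x + r

theorem IsEquimonotone.le_add {T : UCb E → UCb E} (hT : IsEquimonotone T) {f g : UCb E} {r : ℝ}
    (h : ∀ x, f x ≤ g x + r) (x : E) : T f x ≤ T g x + r := by
  simpa using hT f g 0 r (by simpa using h) x

theorem IsEquimonotone.mono {T : UCb E → UCb E} (hT : IsEquimonotone T) {f g : UCb E}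
    (h : ∀ x, f x ≤ g x) (x : E) : T f x ≤ T g x := by
  simpa using hT.le_add (r := 0) (by simpa using h) x

theorem IsEquimonotone.comp {S T : UCb E → UCb E} (hS : IsEquimonotone S)
    (hT : IsEquimonotone T) : IsEquimonotone (S ∘ T) :=
  fun f g z r h => hS _ _ z r (hT f g z r h)

theorem IsEquimonotone.iterate {T : UCb E → UCb E} (hT : IsEquimonotone T) (n : ℕ) :
    IsEquimonotone T^[n] := by
  induction n with
  | zero => exact fun _ _ _ _ h => h
  | succ n ih => exact ih.comp hT

/-- Regrouping ABAB…AB leaves a power of BA flanked by one A and one B, so that a comparison costs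
an error at the two ends only, independent of n. -/
theorem iterate_comp_swap {X : Type*} (A B : X → X) (n : ℕ) (f : X) :
    (A ∘ B)^[n + 1] f = A ((B ∘ A)^[n] (B f)) := by
  induction n generalizing f with
  | zero => rfl
  | succ n ih => rw [Function.iterate_succ_apply, ih]; rfl

/-- Swapping the order in the iteration of two operators close to the identity changes little. -/
theorem iterate_comp_le_iterate_comp_swap {A B : UCb E → UCb E} (hA : IsEquimonotone A)
    (hB : IsEquimonotone B) {f : UCb E} {ε : ℝ} (hε : 0 ≤ ε) (hB₁ : ∀ x, B f x ≤ f x + ε)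
    (hB₂ : ∀ g x, g x ≤ B g x) (hA₁ : ∀ x, f x ≤ A f x + ε)
    (hA₂ : ∀ g : UCb E, (∀ z r, (∀ x, f (x + z) ≤ f x + r) → ∀ x, g (x + z) ≤ g x + r) →
      ∀ x, A g x ≤ g x + ε) (n : ℕ) (x : E) :
    (A ∘ B)^[n] f x ≤ (B ∘ A)^[n] f x + 3 * ε := by
  cases n with
  | zero => simpa using hε
  | succ n =>
    -- With K = (BA)^n, the three errors come from A K B f ≤ A K f + ε, A K f ≤ K f + ε and K f ≤ K
    -- B A f + ε. The second is legitimate because K f inherits every translation bound of f.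
    have hK := (hB.comp hA).iterate n
    have h₁ := hA.le_add (hK.le_add hB₁) x
    have h₂ := hA₂ ((B ∘ A)^[n] f) (fun z r h => hK f f z r h) x
    have h₃ := hK.le_add (f := f) (g := B (A f)) (r := ε)
      (fun y => (hA₁ y).trans (by linarith [hB₂ (A f) y])) x
    rw [iterate_comp_swap, Function.iterate_succ_apply]
    simp only [Function.comp_apply] at h₃ ⊢
    linarith

end Equimonotone

/-! ### The Hopf-Lax semigroup -/

section Operators

variable {E : Type*} [NormedAddCommGroup E] [NormedSpace ℝ E] {c : E → ℝ≥0∞}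

theorem coe_Φ (hc : IsCost c) {t : ℝ≥0} (ht : t ≠ 0) (f : UCb E) (x : E) :
    ((Φ hc t f x : ℝ) : EReal) = hopfLaxSup c t f x := by
  rw [Φ, if_neg ht, UCb.mk_apply, coe_toReal_hopfLaxSup hc]

theorem coe_sub_coe_ennreal {r : ℝ} {t : ℝ≥0} {y : ℝ≥0∞} (hy : y ≠ ∞) :
    ((r : EReal) - ((t * y : ℝ≥0∞) : EReal)) = ((r - t * y.toReal : ℝ) : EReal) := by
  lift y to ℝ≥0 using hy
  norm_cast

/-- Writing a = t b and discarding velocities of infinite cost keeps all later estimates in ℝ and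
covers t = 0 as well. -/
theorem le_Φ_of_ne_top (hc : IsCost c) (t : ℝ≥0) (f : UCb E) (x : E) {b : E} (hb : c b ≠ ∞) :
    f (x + t • b) - t * (c b).toReal ≤ Φ hc t f x := by
  rcases eq_or_ne t 0 with rfl | ht
  · simp [Φ]
  rw [← EReal.coe_le_coe_iff, coe_Φ hc ht, ← coe_sub_coe_ennreal hb]
  refine le_trans ?_ (le_iSup _ (t • b))
  rw [inv_smul_smul₀ ht]

theorem Φ_le (hc : IsCost c) (t : ℝ≥0) (f : UCb E) (x : E) {r : ℝ}
    (h : ∀ b, c b ≠ ∞ → f (x + t • b) - t * (c b).toReal ≤ r) : Φ hc t f x ≤ r := by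
  rcases eq_or_ne t 0 with rfl | ht
  · simpa [Φ, hc.zero] using h 0
  rw [← EReal.coe_le_coe_iff, coe_Φ hc ht]
  refine iSup_le fun a => ?_
  by_cases ha : c (t⁻¹ • a) = ∞
  · simp [ha, ENNReal.mul_top, ht]
  · have := h _ ha
    rw [smul_inv_smul₀ ht] at this
    rw [coe_sub_coe_ennreal ha]
    exact_mod_cast this

theorem exists_lt_Φ (hc : IsCost c) (t : ℝ≥0) (f : UCb E) (x : E) {ε : ℝ} (hε : 0 < ε) :
    ∃ b, c b ≠ ∞ ∧ Φ hc t f x - ε < f (x + t • b) - t * (c b).toReal := by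
  by_contra! h
  have := Φ_le hc t f x h
  linarith

theorem self_le_Φ (hc : IsCost c) (t : ℝ≥0) (f : UCb E) (x : E) : f x ≤ Φ hc t f x := by
  simpa [hc.zero] using le_Φ_of_ne_top hc t f x (b := 0) (by simp [hc.zero])

theorem IsCost.exists_combination (hc : IsCost c) (s t : ℝ≥0) {a b : E} (ha : c a ≠ ∞)
    (hb : c b ≠ ∞) : ∃ d, c d ≠ ∞ ∧ (s + t) • d = s • a + t • b ∧
      (s + t : ℝ) * (c d).toReal ≤ s * (c a).toReal + t * (c b).toReal := by
  rcases eq_or_ne (s + t) 0 with h | h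
  · obtain ⟨rfl, rfl⟩ := add_eq_zero.1 h
    exact ⟨a, ha, by simp, by simp⟩
  · have hconv := hc.convex.2 (Set.mem_univ a) (Set.mem_univ b)
      (zero_le (a := s / (s + t))) (zero_le (a := t / (s + t))) (by rw [← add_div, div_self h])
    have hfin : (s / (s + t)) • c a + (t / (s + t)) • c b ≠ ∞ := by
      simp only [ENNReal.smul_def, smul_eq_mul]
      finiteness
    refine ⟨_, ne_top_of_le_ne_top hfin hconv, ?_, ?_⟩
    · rw [smul_add, smul_smul, smul_smul, mul_div_cancel₀ _ h, mul_div_cancel₀ _ h]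
    · have := ENNReal.toReal_mono hfin hconv
      simp only [ENNReal.smul_def, smul_eq_mul] at this
      rw [ENNReal.toReal_add (by finiteness) (by finiteness), ENNReal.toReal_mul,
        ENNReal.toReal_mul] at this
      simp only [ENNReal.coe_toReal, NNReal.coe_div, NNReal.coe_add] at this
      have h' : (0 : ℝ) < s + t := by exact_mod_cast pos_iff_ne_zero.2 h
      calc _ ≤ (s + t : ℝ) * (s / (s + t) * (c a).toReal + t / (s + t) * (c b).toReal) := by
            gcongr
        _ = _ := by field_simp

/-- The Hopf-Lax semigroup property. -/
theorem Φ_add (hc : IsCost c) (s t : ℝ≥0) (f : UCb E) :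
    Φ hc (s + t) f = Φ hc s (Φ hc t f) := by
  refine UCb.ext fun x => le_antisymm ?_ ?_
  -- The same velocity serves in both time periods.
  · refine Φ_le hc _ _ _ fun b hb => ?_
    have h₁ := le_Φ_of_ne_top hc s (Φ hc t f) x hb
    have h₂ := le_Φ_of_ne_top hc t f (x + s • b) hb
    rw [add_assoc, ← add_smul] at h₂
    push_cast
    linarith
  · refine Φ_le hc _ _ _ fun a ha => ?_
    rw [sub_le_iff_le_add]
    refine Φ_le hc _ _ _ fun b hb => ?_
    -- The time-weighted average velocity reaches the same endpoint and is no more expensive, by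
    -- convexity.
    obtain ⟨d, hd, h₁, h₂⟩ := hc.exists_combination s t ha hb
    have := le_Φ_of_ne_top hc (s + t) f x hd
    rw [h₁, ← add_assoc] at this
    push_cast at this
    linarith

theorem isEquimonotone_Φ (hc : IsCost c) (t : ℝ≥0) : IsEquimonotone (Φ hc t) := by
  intro f g z r h x
  refine Φ_le hc _ _ _ fun b hb => ?_
  have h₁ := h (x + t • b)
  have h₂ := le_Φ_of_ne_top hc t g x hb
  rw [add_right_comm] at h₁
  linarith

/-- By superlinearity of the cost, large displacements are too expensive in a short time. -/
theorem IsCost.exists_mul_le (hc : IsCost c) (M : ℝ) {δ : ℝ} (hδ : 0 < δ) :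
    ∃ h₀ > (0 : ℝ≥0), ∀ h ≤ h₀, ∀ b, c b ≠ ∞ → δ ≤ ‖h • b‖ → M ≤ h * (c b).toReal := by
  obtain ⟨R, hR⟩ : ∃ R : ℝ, ∀ b : E, R < ‖b‖ → ENNReal.ofReal (M / δ) ≤ c b / ‖b‖ₑ := by
    have h := hc.superlinear.eventually (lt_mem_nhds (ENNReal.ofReal_lt_top (r := M / δ)))
    rw [← comap_norm_atTop, eventually_comap] at h
    obtain ⟨R, hR⟩ := eventually_atTop.1 h
    exact ⟨R, fun b hb => (hR _ hb.le b rfl).le⟩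
  -- For such h, a displacement of size δ forces ‖b‖ ≥ 2(|R| + 1) > R, where the cost is at least (M
  -- / δ)‖b‖.
  refine ⟨(δ / (2 * (|R| + 1))).toNNReal, Real.toNNReal_pos.2 (by positivity),
    fun h hh b hb hδb => ?_⟩
  have hh' : (h : ℝ) ≤ δ / (2 * (|R| + 1)) := by
    simpa using (NNReal.coe_le_coe.2 hh).trans_eq (Real.coe_toNNReal _ (by positivity))
  rw [NNReal.smul_def, norm_smul, NNReal.norm_eq] at hδb
  have hb0 : 0 < ‖b‖ := by
    rcases (norm_nonneg b).eq_or_lt with h0 | h0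
    · rw [← h0, mul_zero] at hδb; linarith
    · exact h0
  have hRb : R < ‖b‖ := by
    have h₁ : δ ≤ δ / (2 * (|R| + 1)) * ‖b‖ := hδb.trans (by gcongr)
    rw [div_mul_eq_mul_div, le_div_iff₀ (by positivity)] at h₁
    have := le_of_mul_le_mul_left h₁ hδ
    linarith [le_abs_self R, abs_nonneg R]
  have h₂ : M / δ ≤ (c b).toReal / ‖b‖ := by
    exact (ENNReal.ofReal_le_iff_le_toReal (ENNReal.div_ne_top hb
      (by simpa using norm_pos_iff.1 hb0))).1 (hR b hRb) |>.trans (by simp [ENNReal.toReal_div])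
  rw [le_div_iff₀ hb0, div_mul_eq_mul_div, div_le_iff₀ hδ] at h₂
  have h₃ := ENNReal.toReal_nonneg (a := c b)
  by_contra! hlt
  have h₄ : (h : ℝ) * (c b).toReal * δ < M * δ := by gcongr
  rcases le_or_gt M 0 with hM | hM
  · nlinarith [mul_nonneg h.2 h₃]
  · have h₅ : M * δ ≤ M * (h * ‖b‖) := by gcongr
    have h₆ : h * (M * ‖b‖) ≤ h * ((c b).toReal * δ) := by gcongr
    linarith

theorem Φ_le_add (hc : IsCost c) (f : UCb E) {ε : ℝ} (hε : 0 < ε) :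
    ∃ h₀ > (0 : ℝ≥0), ∀ h ≤ h₀, ∀ x, Φ hc h f x ≤ f x + ε := by
  obtain ⟨δ, hδ, hf⟩ := f.exists_modulus ε hε
  -- No displacement can gain more than 2‖f‖, so those of size at least δ do not pay.
  obtain ⟨h₀, h₀pos, H⟩ := hc.exists_mul_le (2 * ‖f.1‖) hδ
  refine ⟨h₀, h₀pos, fun h hh x => Φ_le hc _ _ _ fun b hb => ?_⟩
  have hnn : 0 ≤ (h : ℝ) * (c b).toReal := mul_nonneg h.2 ENNReal.toReal_nonneg
  rcases lt_or_ge ‖h • b‖ δ with hlt | hge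
  · have := hf (x + h • b) x (by simpa using hlt) 0
    simp only [add_zero] at this
    linarith [(_root_.abs_le.1 this).2]
  · have h₁ := H h hh b hb hge
    linarith [(_root_.abs_le.1 (f.abs_le (x + h • b))).2, (_root_.abs_le.1 (f.abs_le x)).1]

end Operators

/-! ### Averaging operators and their exchange with Φ -/

section Transition

variable {E : Type*} [NormedAddCommGroup E] [TopologicalSpace.SeparableSpace E]
  [MeasurableSpace E] [BorelSpace E]

theorem UCb.integrable_add (μ : ProbabilityMeasure E) (f : UCb E) (x : E) :
    Integrable (fun y => f (x + y)) (μ : Measure E) :=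
  have : SecondCountableTopology E := UniformSpace.secondCountable_of_separable E
  f.integrable_comp _ (by fun_prop)

theorem transition_apply (μ : ProbabilityMeasure E) (f : UCb E) (x : E) :
    transition μ f x = ∫ y, f (x + y) ∂(μ : Measure E) := rfl

theorem isEquimonotone_transition (μ : ProbabilityMeasure E) : IsEquimonotone (transition μ) := by
  intro f g z r h x
  have : transition μ g x + r = ∫ y, (g (x + y) + r) ∂(μ : Measure E) := by
    rw [integral_add (g.integrable_add μ x) (integrable_const r), transition_apply]; simp
  rw [this, transition_apply]
  refine integral_mono (f.integrable_add μ _)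
    ((g.integrable_add μ x).add (integrable_const r)) fun y => ?_
  simpa [add_right_comm] using h (x + y)

/-- Small jumps are controlled by the modulus, large ones by their mass. The hypotheses are
one-sided translation bounds because exactly these pass to iterates of equimonotone operators. -/
theorem transition_le_add (μ : ProbabilityMeasure E) {f : UCb E} {δ ε C : ℝ} (hε : 0 ≤ ε)
    (h₁ : ∀ x z, ‖z‖ < δ → f (x + z) ≤ f x + ε) (h₂ : ∀ x z, f (x + z) ≤ f x + C)
    (x : E) : transition μ f x ≤ f x + (ε + C * (μ : Measure E).real {y | δ ≤ ‖y‖}) := by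
  have hm : MeasurableSet {y : E | δ ≤ ‖y‖} := measurableSet_le measurable_const measurable_norm
  have hi : Integrable (fun y : E => (f x + ε) + {y : E | δ ≤ ‖y‖}.indicator (fun _ => C) y)
      (μ : Measure E) := (integrable_const _).add ((integrable_const C).indicator hm)
  calc transition μ f x
      ≤ ∫ y, ((f x + ε) + {y : E | δ ≤ ‖y‖}.indicator (fun _ => C) y) ∂(μ : Measure E) := by
        refine integral_mono (f.integrable_add μ x) hi fun y => ?_
        by_cases hy : δ ≤ ‖y‖
        · simp only [Set.indicator, Set.mem_ofPred_eq, hy, if_true]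
          linarith [h₂ x y]
        · simp only [Set.indicator, Set.mem_ofPred_eq, hy, if_false]
          linarith [h₁ x y (not_le.1 hy)]
    _ = _ := by
        rw [integral_add (integrable_const _) ((integrable_const C).indicator hm),
          integral_indicator_const _ hm]
        simp; ring

theorem sub_le_transition (μ : ProbabilityMeasure E) {f : UCb E} {δ ε C : ℝ} (hε : 0 ≤ ε)
    (h₁ : ∀ x z, ‖z‖ < δ → f x ≤ f (x + z) + ε) (h₂ : ∀ x z, f x ≤ f (x + z) + C)
    (x : E) : f x ≤ transition μ f x + (ε + C * (μ : Measure E).real {y | δ ≤ ‖y‖}) := by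
  have hm : MeasurableSet {y : E | δ ≤ ‖y‖} := measurableSet_le measurable_const measurable_norm
  have hi : Integrable (fun y : E => (f x - ε) - {y : E | δ ≤ ‖y‖}.indicator (fun _ => C) y)
      (μ : Measure E) := (integrable_const _).sub ((integrable_const C).indicator hm)
  rw [← sub_le_iff_le_add]
  calc f x - (ε + C * (μ : Measure E).real {y | δ ≤ ‖y‖})
      = ∫ y, ((f x - ε) - {y : E | δ ≤ ‖y‖}.indicator (fun _ => C) y) ∂(μ : Measure E) := by
        rw [integral_sub (integrable_const _) ((integrable_const C).indicator hm),
          integral_indicator_const _ hm]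
        simp; ring
    _ ≤ _ := by
        refine integral_mono hi (f.integrable_add μ x) fun y => ?_
        by_cases hy : δ ≤ ‖y‖
        · simp only [Set.indicator, Set.mem_ofPred_eq, hy, if_true]
          linarith [h₂ x y]
        · simp only [Set.indicator, Set.mem_ofPred_eq, hy, if_false]
          linarith [h₁ x y (not_le.1 hy)]

variable [NormedSpace ℝ E] {c : E → ℝ≥0∞}

/-- For a fixed velocity, translation commutes with averaging; the supremum over velocities is then
taken outside the average on the left and inside it on the right. -/
theorem Φ_transition_le (hc : IsCost c) (t : ℝ≥0) (μ : ProbabilityMeasure E) (f : UCb E) (x : E) :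
    Φ hc t (transition μ f) x ≤ transition μ (Φ hc t f) x := by
  refine Φ_le hc _ _ _ fun b hb => ?_
  rw [sub_le_iff_le_add]
  have := isEquimonotone_transition μ f (Φ hc t f) (t • b) (t * (c b).toReal) (fun y => by
    linarith [le_Φ_of_ne_top hc t f y hb]) x
  exact this

theorem J_eq (hc : IsCost c) (μ : ℝ≥0 → ProbabilityMeasure E) {t : ℝ≥0} (ht : t ≠ 0) :
    J hc μ t = Φ hc t ∘ transition (μ t) := by
  funext f; simp [J, ht]

theorem I_eq (hc : IsCost c) (μ : ℝ≥0 → ProbabilityMeasure E) {t : ℝ≥0} (ht : t ≠ 0) :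
    I hc μ t = transition (μ t) ∘ Φ hc t := by
  funext f; simp [I, ht]

end Transition

/-! ### Adaptedness of time integrals without progressive measurability -/

section Measurability

variable {Ω : Type*} {m' m : MeasurableSpace Ω} {P : Measure Ω} [IsProbabilityMeasure P]
  {E : Type*} [NormedAddCommGroup E] [NormedSpace ℝ E] [CompleteSpace E]

/-- Conditional expectation is self-adjoint. -/
theorem integral_condExp_smul (hm : m' ≤ m) {q : Ω → ℝ} {C : ℝ} (hq : Integrable q P)
    (hqC : ∀ ω, |q ω| ≤ C) {Z : Ω → E} (hZ : Integrable Z P) :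
    ∫ ω, (P[q|m']) ω • Z ω ∂P = ∫ ω, q ω • (P[Z|m']) ω ∂P := by
  have hb : ∀ᵐ ω ∂P, ‖(P[q|m']) ω‖ ≤ C := ae_bdd_abs_condExp_of_ae_bdd_abs (ae_of_all _ hqC)
  have h₁ : Integrable (P[q|m'] • Z) P :=
    hZ.bdd_smul C (stronglyMeasurable_condExp.mono hm).aestronglyMeasurable hb
  have h₂ : Integrable (q • P[Z|m']) P :=
    integrable_condExp.bdd_smul C hq.aestronglyMeasurable (ae_of_all _ hqC)
  calc ∫ ω, (P[q|m']) ω • Z ω ∂P = ∫ ω, (P[P[q|m'] • Z|m']) ω ∂P := (integral_condExp hm).symm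
    _ = ∫ ω, (P[q|m'] • P[Z|m']) ω ∂P := integral_congr_ae
        (condExp_smul_of_aestronglyMeasurable_left
          stronglyMeasurable_condExp.aestronglyMeasurable h₁ hZ)
    _ = ∫ ω, (P[q • P[Z|m']|m']) ω ∂P := integral_congr_ae
        (condExp_smul_of_aestronglyMeasurable_right hq h₂
          stronglyMeasurable_condExp.aestronglyMeasurable).symm
    _ = _ := integral_condExp hm

/-- Joint measurability is known only for the large σ-algebra, so Fubini does not apply over `m'`
directly. Instead, the integral is shown to equal its own conditional expectation. -/
theorem aestronglyMeasurable_integral_of_bounded {U : Type*} [MeasurableSpace U] {ν : Measure U}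
    [IsFiniteMeasure ν] (hm : m' ≤ m) {a : U → Ω → E}
    (ha : StronglyMeasurable (Function.uncurry a)) {C : ℝ} (hC : ∀ u ω, ‖a u ω‖ ≤ C)
    (ha' : ∀ᵐ u ∂ν, StronglyMeasurable[m'] (a u)) :
    AEStronglyMeasurable[m'] (fun ω => ∫ u, a u ω ∂ν) P := by
  have hint : Integrable (Function.uncurry a) (ν.prod P) :=
    Integrable.of_bound ha.aestronglyMeasurable C (ae_of_all _ fun p => hC p.1 p.2)
  have hZ : Integrable (fun ω => ∫ u, a u ω ∂ν) P := hint.integral_prod_right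
  refine ⟨P[fun ω => ∫ u, a u ω ∂ν|m'], stronglyMeasurable_condExp,
    hZ.ae_eq_of_forall_setIntegral_eq _ _ integrable_condExp fun B hB _ => ?_⟩
  set q : Ω → ℝ := B.indicator fun _ => 1 with hq_def
  have hq : Integrable q P := (integrable_const 1).indicator hB
  have hq1 : ∀ ω, |q ω| ≤ 1 := fun ω => by
    by_cases h : ω ∈ B <;> simp [q, h]
  have hset : ∀ W : Ω → E, ∫ ω in B, W ω ∂P = ∫ ω, q ω • W ω ∂P := fun W => by
    rw [← integral_indicator hB]
    congr 1; ext ω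
    by_cases h : ω ∈ B <;> simp [q, h]
  have hb : ∀ᵐ ω ∂P, ‖(P[q|m']) ω‖ ≤ 1 := ae_bdd_abs_condExp_of_ae_bdd_abs (ae_of_all _ hq1)
  have hswap : ∀ r : Ω → ℝ, AEStronglyMeasurable r P → (∀ᵐ ω ∂P, ‖r ω‖ ≤ 1) →
      ∫ ω, r ω • ∫ u, a u ω ∂ν ∂P = ∫ u, ∫ ω, r ω • a u ω ∂P ∂ν := fun r hr hr1 => by
    simp_rw [← integral_smul]
    refine integral_integral_swap ?_
    have hint' : Integrable (fun p : Ω × U => a p.2 p.1) (P.prod ν) := hint.swap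
    refine hint'.bdd_smul (φ := fun p : Ω × U => r p.1) 1 hr.comp_fst ?_
    exact Measure.quasiMeasurePreserving_fst.ae hr1
  -- Conditioning is moved onto the test function q, Fubini is applied over `m`, and for almost
  -- every u conditioning is moved back onto a u, which it fixes.
  rw [hset, hset, ← integral_condExp_smul hm hq hq1 hZ, hswap _ hq.aestronglyMeasurable
    (ae_of_all _ hq1), hswap _ (stronglyMeasurable_condExp.mono hm).aestronglyMeasurable hb]
  refine integral_congr_ae ?_
  filter_upwards [ha'] with u hu
  have hau : Integrable (a u) P :=
    Integrable.of_bound (hu.mono hm).aestronglyMeasurable C (ae_of_all _ (hC u))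
  rw [integral_condExp_smul hm hq hq1 hau, condExp_of_stronglyMeasurable hm hu hau]

theorem aestronglyMeasurable_of_tendsto {Z : ℕ → Ω → E} {W : Ω → E}
    (hZ : ∀ n, AEStronglyMeasurable[m'] (Z n) P)
    (h : ∀ᵐ ω ∂P, Tendsto (fun n => Z n ω) atTop (𝓝 (W ω))) : AEStronglyMeasurable[m'] W P := by
  refine ⟨fun ω => limUnder atTop fun n => (hZ n).mk (Z n) ω,
    @StronglyMeasurable.limUnder _ _ _ m' _ _ _ _ _ _ _ fun n => (hZ n).stronglyMeasurable_mk, ?_⟩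
  filter_upwards [h, ae_all_iff.2 fun n => (hZ n).ae_eq_mk] with ω h₁ h₂
  refine (Tendsto.limUnder_eq ?_).symm
  simpa only [← h₂] using h₁

/-- The time integral of a jointly measurable process whose values are measurable for `m'` is
almost surely equal to an `m'`-measurable random variable. -/
theorem aestronglyMeasurable_integral {U : Type*} [MeasurableSpace U] {ν : Measure U}
    [IsFiniteMeasure ν] (hm : m' ≤ m) {a : U → Ω → E}
    (ha : StronglyMeasurable (Function.uncurry a))
    (ha' : ∀ᵐ u ∂ν, StronglyMeasurable[m'] (a u))
    (hi : ∀ᵐ ω ∂P, Integrable (fun u => a u ω) ν) :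
    AEStronglyMeasurable[m'] (fun ω => ∫ u, a u ω ∂ν) P := by
  have hind : ∀ (n : ℕ) (u : U) (ω : Ω), {ω | ‖a u ω‖ ≤ n}.indicator (a u) ω =
      {p : U × Ω | ‖Function.uncurry a p‖ ≤ n}.indicator (Function.uncurry a) (u, ω) := by
    intro n u ω
    by_cases h : ‖a u ω‖ ≤ n <;> simp [Set.indicator, h]
  -- Truncating the values of a at norm n reduces to the bounded case; dominated convergence along
  -- each path removes the truncation.
  refine aestronglyMeasurable_of_tendsto
    (Z := fun n ω => ∫ u, {ω | ‖a u ω‖ ≤ (n : ℝ)}.indicator (a u) ω ∂ν) (fun n => ?_) ?_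
  · refine aestronglyMeasurable_integral_of_bounded hm (C := n) ?_ (fun u ω => ?_) ?_
    · have : (Function.uncurry fun u ω => {ω | ‖a u ω‖ ≤ (n : ℝ)}.indicator (a u) ω) =
          {p : U × Ω | ‖Function.uncurry a p‖ ≤ n}.indicator (Function.uncurry a) :=
        funext fun p => hind n p.1 p.2
      rw [this]
      exact ha.indicator (ha.norm.measurable measurableSet_Iic)
    · by_cases h : ‖a u ω‖ ≤ n <;> simp [Set.indicator, h]
    · filter_upwards [ha'] with u hu
      exact hu.indicator (hu.norm.measurable measurableSet_Iic)
  · filter_upwards [hi] with ω hω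
    refine tendsto_integral_of_dominated_convergence (fun u => ‖a u ω‖) (fun n => ?_) hω.norm
      (fun n => ae_of_all _ fun u => ?_) (ae_of_all _ fun u => ?_)
    · simp_rw [hind]
      exact ((ha.indicator (ha.norm.measurable measurableSet_Iic)).comp_measurable
        (measurable_id.prodMk measurable_const)).aestronglyMeasurable
    · exact norm_indicator_le_norm_self _ _
    · obtain ⟨N, hN⟩ := exists_nat_ge ‖a u ω‖
      refine tendsto_const_nhds.congr' ?_
      filter_upwards [eventually_ge_atTop N] with n hn
      have : ‖a u ω‖ ≤ n := hN.trans (by exact_mod_cast hn)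
      simp [Set.indicator, this]

end Measurability

/-! ### Markov property and short-time behaviour of the noise -/

section Levy

theorem IsLevyProcess.hasLaw_sub {Ω : Type*} {m : MeasurableSpace Ω} {P : Measure Ω} {E : Type*}
    [NormedAddCommGroup E] [MeasurableSpace E] {𝓕 : Filtration ℝ≥0 m} {Y : ℝ≥0 → Ω → E} (hY : IsLevyProcess 𝓕 P Y) {μ : ℝ≥0 → ProbabilityMeasure E}
    {t : ℝ≥0} (hμ : HasLaw (Y t) (μ t : Measure E) P) (s : ℝ≥0) :
    HasLaw (Y (s + t) - Y s) (μ t : Measure E) P :=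
  ⟨(hY.stationary s t).aemeasurable_fst, (hY.stationary s t).map_eq.trans hμ.map_eq⟩

variable {Ω : Type*} {m : MeasurableSpace Ω} {P : Measure Ω} [IsProbabilityMeasure P]
  {E : Type*} [NormedAddCommGroup E] [TopologicalSpace.SeparableSpace E] [MeasurableSpace E]
  [BorelSpace E] {𝓕 : Filtration ℝ≥0 m} {Y : ℝ≥0 → Ω → E}

/-- The Markov property at time `s`. -/
theorem IsLevyProcess.integral_add_increment (hY : IsLevyProcess 𝓕 P Y)
    {μ : ℝ≥0 → ProbabilityMeasure E} {t : ℝ≥0} (hμ : HasLaw (Y t) (μ t : Measure E) P) (s : ℝ≥0)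
    (f : UCb E) {U : Ω → E} (hU : AEStronglyMeasurable[𝓕 s] U P) :
    ∫ ω, f (U ω + (Y (s + t) ω - Y s ω)) ∂P = ∫ ω, transition (μ t) f (U ω) ∂P := by
  have : SecondCountableTopology E := UniformSpace.secondCountable_of_separable E
  have hlaw := hY.hasLaw_sub hμ s
  obtain ⟨U', hU', hUU'⟩ := hU
  have hind : IndepFun U' (Y (s + t) - Y s) P := by
    rw [IndepFun_iff_Indep]
    exact (indep_of_indep_of_le_right (hY.indep s (s + t) le_self_add)
      hU'.measurable.comap_le).symm
  have hU'm : AEMeasurable U' P := (hU'.mono (𝓕.le s)).measurable.aemeasurable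
  have hprod := (indepFun_iff_map_prod_eq_prod_map_map hU'm hlaw.aemeasurable).1 hind
  have : IsProbabilityMeasure (P.map U') := Measure.isProbabilityMeasure_map hU'm
  have hfc : Continuous fun p : E × E => f (p.1 + p.2) :=
    f.1.continuous.comp (continuous_fst.add continuous_snd)
  calc ∫ ω, f (U ω + (Y (s + t) ω - Y s ω)) ∂P
      = ∫ ω, f (U' ω + (Y (s + t) ω - Y s ω)) ∂P := by
        refine integral_congr_ae ?_
        filter_upwards [hUU'] with ω hω
        rw [hω]
    _ = ∫ p, f (p.1 + p.2) ∂(P.map fun ω => (U' ω, (Y (s + t) - Y s) ω)) :=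
        (integral_map (hU'm.prodMk hlaw.aemeasurable) hfc.aestronglyMeasurable).symm
    _ = ∫ u, ∫ w, f (u + w) ∂(μ t : Measure E) ∂(P.map U') := by
        rw [hprod, hlaw.map_eq]
        refine integral_prod _ (Integrable.of_bound hfc.aestronglyMeasurable ‖f.1‖
          (ae_of_all _ fun p => f.abs_le _))
    _ = ∫ ω, transition (μ t) f (U' ω) ∂P :=
        integral_map hU'm (transition (μ t) f).1.continuous.aestronglyMeasurable
    _ = _ := by
        refine integral_congr_ae ?_
        filter_upwards [hUU'] with ω hω
        rw [hω]

/-- This is the Markov property with U = x + Y_s. -/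
theorem IsLevyProcess.transition_add (hY : IsLevyProcess 𝓕 P Y) {μ : ℝ≥0 → ProbabilityMeasure E}
    {s t : ℝ≥0} (hs : HasLaw (Y s) (μ s : Measure E) P) (ht : HasLaw (Y t) (μ t : Measure E) P)
    (hst : HasLaw (Y (s + t)) (μ (s + t) : Measure E) P) (f : UCb E) :
    transition (μ (s + t)) f = transition (μ s) (transition (μ t) f) := by
  have : SecondCountableTopology E := UniformSpace.secondCountable_of_separable E
  have key : ∀ {r : ℝ≥0} (_ : HasLaw (Y r) (μ r : Measure E) P) (g : UCb E) (x : E),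
      transition (μ r) g x = ∫ ω, g (x + Y r ω) ∂P := fun {r} hr g x => by
    rw [transition_apply, ← hr.map_eq, integral_map hr.aemeasurable]
    exact (g.1.continuous.comp (continuous_const_add x)).aestronglyMeasurable
  refine UCb.ext fun x => ?_
  rw [key hst, key hs, ← hY.integral_add_increment ht s f
    ((hY.adapted s).const_add x).aestronglyMeasurable]
  simp

theorem IsLevyProcess.tendsto_measureReal (hY : IsLevyProcess 𝓕 P Y)
    {μ : ℝ≥0 → ProbabilityMeasure E} (hμ : ∀ t, 0 < t → HasLaw (Y t) (μ t : Measure E) P) {δ : ℝ}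
    (hδ : 0 < δ) : Tendsto (fun t => (μ t : Measure E).real {y | δ ≤ ‖y‖}) (𝓝[>] 0) (𝓝 0) := by
  have h := hY.tendstoInMeasure 0 (ENNReal.ofReal δ) (ENNReal.ofReal_pos.2 hδ)
  have h' := (ENNReal.tendsto_toReal ENNReal.zero_ne_top).comp 
    (h.mono_left (nhdsWithin_le_nhds (s := Set.Ioi 0)))
  refine h'.congr' ?_
  filter_upwards [self_mem_nhdsWithin] with t ht
  rw [← (hμ t ht).measureReal_eq (measurableSet_le measurable_const measurable_norm), measureReal_def]
  refine congrArg ENNReal.toReal (measure_congr ?_)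
  filter_upwards [hY.zero] with ω hω
  apply propext
  change ENNReal.ofReal δ ≤ edist (Y t ω) (Y 0 ω) ↔ δ ≤ ‖Y t ω‖
  rw [hω, edist_zero_right, ← ofReal_norm, ENNReal.ofReal_le_ofReal_iff (norm_nonneg _)]

/-- Close to time zero, the iterates of `I` and `J` differ little. -/
theorem IsLevyProcess.exists_iterate_I_le [NormedSpace ℝ E] {c : E → ℝ≥0∞} (hc : IsCost c)
    (hY : IsLevyProcess 𝓕 P Y) {μ : ℝ≥0 → ProbabilityMeasure E}
    (hμ : ∀ t, 0 < t → HasLaw (Y t) (μ t : Measure E) P) (f : UCb E) {ε : ℝ} (hε : 0 < ε) :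
    ∀ᶠ h in 𝓝[>] 0, ∀ n x, (I hc μ h)^[n] f x ≤ (J hc μ h)^[n] f x + ε := by
  -- Each of the three swapping errors gets ε / 3; for the averages it splits into ε / 6 for small
  -- jumps and ε / 6 for the mass of large ones.
  obtain ⟨h₀, h₀pos, hΦ⟩ := Φ_le_add hc f (ε := ε / 3) (by positivity)
  obtain ⟨δ, hδ, hf⟩ := f.exists_modulus (ε / 6) (by positivity)
  have hf₁ : ∀ z, ‖z‖ < δ → ∀ x, f (x + z) ≤ f x + ε / 6 := fun z hz x => by
    have := hf (x + z) x (by simpa using hz) 0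
    simp only [add_zero] at this
    linarith [(_root_.abs_le.1 this).2]
  have hf₂ : ∀ z x, f (x + z) ≤ f x + 2 * ‖f.1‖ := fun z x => by
    linarith [(_root_.abs_le.1 (f.abs_le (x + z))).2, (_root_.abs_le.1 (f.abs_le x)).1]
  have hsmall : ∀ᶠ h in 𝓝[>] (0 : ℝ≥0),
      2 * ‖f.1‖ * (μ h : Measure E).real {y | δ ≤ ‖y‖} < ε / 6 := by
    have := (hY.tendsto_measureReal hμ hδ).const_mul (2 * ‖f.1‖)
    rw [mul_zero] at this
    exact this.eventually (gt_mem_nhds (by positivity))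
  filter_upwards [hsmall, self_mem_nhdsWithin, nhdsWithin_le_nhds (Iic_mem_nhds h₀pos)]
    with h h₁ h₂ h₃ n x
  rw [I_eq hc μ (ne_of_gt h₂), J_eq hc μ (ne_of_gt h₂)]
  refine (iterate_comp_le_iterate_comp_swap (isEquimonotone_transition (μ h))
    (isEquimonotone_Φ hc h) (ε := ε / 3) (by positivity) (hΦ h h₃) (self_le_Φ hc h)
    (fun x => ?_) (fun g hg x => ?_) n x).trans_eq (by ring)
  · refine (sub_le_transition (μ h) (δ := δ) (ε := ε / 6) (C := 2 * ‖f.1‖) (by positivity)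
      (fun x z hz => ?_) (fun x z => ?_) x).trans (by linarith)
    · simpa using hf₁ (-z) (by simpa using hz) (x + z)
    · simpa using hf₂ (-z) (x + z)
  -- Here g stands for an iterate of f; `hg` transfers the bounds of f to it, which makes the choice
  -- of h uniform in n.
  · exact (transition_le_add (μ h) (δ := δ) (ε := ε / 6) (C := 2 * ‖f.1‖) (by positivity)
      (fun x z hz => hg z _ (hf₁ z hz) x) (fun x z => hg z _ (hf₂ z) x) x).trans (by linarith)

end Levy

/-! ### The closed convex hull of the cost and Jensen's inequality -/

section Hull

variable {E : Type*} [NormedAddCommGroup E] {c : E → ℝ≥0∞}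

/-- The closure of the epigraph of the cost. -/
def closedEpigraph (c : E → ℝ≥0∞) : Set (E × ℝ) :=
  closure {p | c p.1 ≠ ∞ ∧ (c p.1).toReal ≤ p.2}

/-- The lower semicontinuous hull of the cost. -/
noncomputable def closedHull (c : E → ℝ≥0∞) (a : E) : ℝ≥0∞ :=
  ⨅ (r : ℝ≥0) (_ : (a, (r : ℝ)) ∈ closedEpigraph c), (r : ℝ≥0∞)

theorem closedEpigraph_mono {a : E} {r r' : ℝ} (h : (a, r) ∈ closedEpigraph c) (hr : r ≤ r') :
    (a, r') ∈ closedEpigraph c := by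
  have hcont : Continuous fun p : E × ℝ => (p.1, p.2 + (r' - r)) := by fun_prop
  have := map_mem_closure hcont h (t := {p | c p.1 ≠ ∞ ∧ (c p.1).toReal ≤ p.2})
    fun p hp => ⟨hp.1, by have := hp.2; dsimp only; linarith⟩
  simpa [closedEpigraph] using this

/-- The infimum is attained, because the epigraph is closed and stable under raising the second
coordinate. -/
theorem closedHull_le_coe_iff {a : E} {r : ℝ≥0} :
    closedHull c a ≤ r ↔ (a, (r : ℝ)) ∈ closedEpigraph c := by
  refine ⟨fun h => ?_, fun h => iInf₂_le r h⟩
  have hmem : ∀ ε > (0 : ℝ), (a, r + ε) ∈ closedEpigraph c := fun ε hε => by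
    have hlt : closedHull c a < (r + ε.toNNReal : ℝ≥0) :=
      h.trans_lt (ENNReal.coe_lt_coe.2 (lt_add_of_pos_right _ (Real.toNNReal_pos.2 hε)))
    obtain ⟨r', hr'⟩ := iInf_lt_iff.1 hlt
    obtain ⟨hK, hr'⟩ := iInf_lt_iff.1 hr'
    refine closedEpigraph_mono hK ?_
    have : (r' : ℝ) < r + ε.toNNReal := by exact_mod_cast hr'
    rw [Real.coe_toNNReal _ hε.le] at this
    exact this.le
  have hlim : Tendsto (fun ε : ℝ => (a, r + ε)) (𝓝[>] 0) (𝓝 (a, (r : ℝ))) := by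
    have : Continuous fun ε : ℝ => (a, (r : ℝ) + ε) := by fun_prop
    simpa using (this.tendsto 0).mono_left nhdsWithin_le_nhds
  exact isClosed_closure.mem_of_tendsto hlim (eventually_mem_nhdsWithin.mono hmem)

theorem closedHull_le (a : E) : closedHull c a ≤ c a := by
  by_cases h : c a = ∞
  · simp [h]
  · rw [← ENNReal.coe_toNNReal h, closedHull_le_coe_iff]
    exact subset_closure ⟨h, le_rfl⟩

theorem mem_closedEpigraph_closedHull {a : E} (h : closedHull c a ≠ ∞) :
    (a, (closedHull c a).toReal) ∈ closedEpigraph c :=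
  closedHull_le_coe_iff.1 (ENNReal.coe_toNNReal h).ge

/-- This makes the hull Borel, as integration in Jensen's inequality requires. -/
theorem lowerSemicontinuous_closedHull : LowerSemicontinuous (closedHull c) := by
  rw [lowerSemicontinuous_iff_isClosed_preimage]
  intro y
  induction y with
  | top => simp
  | coe r =>
    have : closedHull c ⁻¹' Set.Iic (r : ℝ≥0∞) = (fun a => (a, (r : ℝ))) ⁻¹' closedEpigraph c :=
      Set.ext fun a => closedHull_le_coe_iff
    rw [this]
    exact isClosed_closure.preimage (by fun_prop)

variable [NormedSpace ℝ E]

theorem IsCost.convex_closedEpigraph (hc : IsCost c) : Convex ℝ (closedEpigraph c) := by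
  refine Convex.closure fun p hp q hq a b ha hb hab => ?_
  lift a to ℝ≥0 using ha
  lift b to ℝ≥0 using hb
  have hab' : a + b = 1 := by exact_mod_cast hab
  obtain ⟨d, hd, h₁, h₂⟩ := hc.exists_combination a b hp.1 hq.1
  rw [hab', one_smul] at h₁
  rw [hab, one_mul, h₁] at h₂
  rw [h₁] at hd
  refine ⟨hd, h₂.trans ?_⟩
  simp only [Prod.snd_add, Prod.smul_snd, smul_eq_mul]
  gcongr
  exacts [hp.2, hq.2]

/-- Replacing the cost by its hull does not enlarge the Hopf-Lax supremum: by continuity of f, the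
bound is a closed condition on p. -/
theorem le_Φ_of_mem_closedEpigraph (hc : IsCost c) (t : ℝ≥0) (f : UCb E) (x : E) {p : E × ℝ}
    (hp : p ∈ closedEpigraph c) : f (x + t • p.1) - t * p.2 ≤ Φ hc t f x := by
  have hf := f.1.continuous
  have hclosed : IsClosed {p : E × ℝ | f (x + t • p.1) - t * p.2 ≤ Φ hc t f x} :=
    isClosed_le (by fun_prop) continuous_const
  refine closure_minimal (fun q hq => ?_) hclosed hp
  have h₁ := le_Φ_of_ne_top hc t f x hq.1
  have h₂ : (t : ℝ) * (c q.1).toReal ≤ t * q.2 := by gcongr; exact hq.2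
  simp only [Set.mem_ofPred_eq]
  linarith

/-- A displacement by an integral is at least as expensive as Hopf-Lax suggests. The cost need
neither be measurable nor lower semicontinuous. -/
theorem ofReal_sub_Φ_le_lintegral [CompleteSpace E] [MeasurableSpace E] [BorelSpace E]
    (hc : IsCost c) {t : ℝ≥0} (ht : t ≠ 0) (f : UCb E) (x : E) {U : Type*} [MeasurableSpace U]
    {ν : Measure U} (hν : ν Set.univ = t) {α : U → E} (hα : Integrable α ν) :
    ENNReal.ofReal (f (x + ∫ u, α u ∂ν) - Φ hc t f x) ≤ ∫⁻ u, c (α u) ∂ν := by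
  have : IsFiniteMeasure ν := ⟨by rw [hν]; exact ENNReal.coe_lt_top⟩
  have : NeZero ν := ⟨fun h => ht (by simpa [h] using hν.symm)⟩
  refine le_trans ?_ (lintegral_mono fun u => closedHull_le (α u))
  have hm : AEMeasurable (fun u => closedHull c (α u)) ν :=
    lowerSemicontinuous_closedHull.measurable.comp_aemeasurable hα.aemeasurable
  by_cases hfin : ∫⁻ u, closedHull c (α u) ∂ν = ∞
  · simp [hfin]
  have hae := ae_lt_top' hm hfin
  have hint : Integrable (fun u => (closedHull c (α u)).toReal) ν :=
    integrable_toReal_of_lintegral_ne_top hm hfin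
  -- Jensen: the barycentre of points of a closed convex set stays in the set.
  have hmem := hc.convex_closedEpigraph.average_mem isClosed_closure (μ := ν)
    (f := fun u => (α u, (closedHull c (α u)).toReal))
    (hae.mono fun u hu => mem_closedEpigraph_closedHull hu.ne) (hα.prodMk hint)
  have key := le_Φ_of_mem_closedEpigraph hc t f x hmem
  have hνr : ν.real Set.univ = t := by rw [measureReal_def, hν]; rfl
  have ht' : (t : ℝ) ≠ 0 := by exact_mod_cast ht
  rw [average_eq, hνr, integral_pair hα hint, NNReal.smul_def, Prod.smul_fst, Prod.smul_snd,
    smul_inv_smul₀ ht', smul_eq_mul, mul_inv_cancel_left₀ ht', integral_toReal hm hae] at key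
  rw [ENNReal.ofReal_le_iff_le_toReal hfin]
  linarith

end Hull

/-! ### The value function -/

section Value

variable {Ω : Type*} {m : MeasurableSpace Ω} {P : Measure Ω} [IsProbabilityMeasure P]
  {E : Type*} [NormedAddCommGroup E] [NormedSpace ℝ E] [MeasurableSpace E]
  {𝓕 : Filtration ℝ≥0 m} {Y : ℝ≥0 → Ω → E} {c : E → ℝ≥0∞}

theorem coe_V (hc : IsCost c) (hY : IsLevyProcess 𝓕 P Y) (t : ℝ≥0) (f : UCb E) (x : E) :
    ((V hc hY t f x : ℝ) : EReal) = valueSup c 𝓕 P Y t f x := by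
  rw [V, UCb.mk_apply, coe_toReal_valueSup hc]

theorem le_V (hc : IsCost c) (hY : IsLevyProcess 𝓕 P Y) (t : ℝ≥0) (f : UCb E) (x : E)
    {α : ℝ≥0 → Ω → E} (hα : α ∈ admissible (E := E) 𝓕 P) (hfin : runningCost c P α t ≠ ∞) :
    ∫ ω, f (controlled Y α t x ω) ∂P - (runningCost c P α t).toReal ≤ V hc hY t f x := by
  rw [← EReal.coe_le_coe_iff, coe_V hc hY]
  refine le_trans (le_of_eq ?_) (le_iSup _ (⟨α, hα⟩ : admissible (E := E) 𝓕 P))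
  simpa using (coe_sub_coe_ennreal (t := 1) hfin).symm

theorem V_le (hc : IsCost c) (hY : IsLevyProcess 𝓕 P Y) (t : ℝ≥0) (f : UCb E) (x : E) {r : ℝ}
    (h : ∀ α ∈ admissible (E := E) 𝓕 P, runningCost c P α t ≠ ∞ →
      ∫ ω, f (controlled Y α t x ω) ∂P - (runningCost c P α t).toReal ≤ r) :
    V hc hY t f x ≤ r := by
  rw [← EReal.coe_le_coe_iff, coe_V hc hY]
  refine iSup_le fun α => ?_
  by_cases hfin : runningCost c P α t = ∞
  · simp [hfin]
  · have := h α α.2 hfin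
    have heq := coe_sub_coe_ennreal (r := ∫ ω, f (controlled Y α t x ω) ∂P) (t := 1) hfin
    simp only [ENNReal.coe_one, one_mul, NNReal.coe_one] at heq
    rw [heq]
    exact_mod_cast this

theorem stronglyMeasurable_control {α : ℝ≥0 → Ω → E} (hα : α ∈ admissible (E := E) 𝓕 P) :
    StronglyMeasurable (Function.uncurry fun (u : ℝ) ω => α u.toNNReal ω) :=
  hα.2.1.comp_measurable ((measurable_real_toNNReal.comp measurable_fst).prodMk measurable_snd)

theorem stronglyMeasurable_controlled (hY : IsLevyProcess 𝓕 P Y) {α : ℝ≥0 → Ω → E}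
    (hα : α ∈ admissible (E := E) 𝓕 P) (t : ℝ≥0) (x : E) :
    StronglyMeasurable (controlled Y α t x) := by
  have h : StronglyMeasurable fun ω => ∫ u in Set.Ioc 0 (t : ℝ), α u.toNNReal ω :=
    (stronglyMeasurable_control hα).integral_prod_left
  exact (((hY.adapted t).mono (𝓕.le t)).add h).const_add x

/-- The controlled process is almost surely equal to an adapted one. -/
theorem aestronglyMeasurable_controlled [CompleteSpace E] (hY : IsLevyProcess 𝓕 P Y)
    {α : ℝ≥0 → Ω → E} (hα : α ∈ admissible (E := E) 𝓕 P) (t : ℝ≥0) (x : E) :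
    AEStronglyMeasurable[𝓕 t] (controlled Y α t x) P := by
  have h : AEStronglyMeasurable[𝓕 t] (fun ω => ∫ u in Set.Ioc 0 (t : ℝ), α u.toNNReal ω) P := by
    refine aestronglyMeasurable_integral (𝓕.le t) (stronglyMeasurable_control hα) ?_
      (hα.2.2.mono fun ω hω => hω t)
    refine (ae_restrict_iff' measurableSet_Ioc).2 (ae_of_all _ fun u hu => ?_)
    exact (hα.1 _).mono (𝓕.mono (Real.toNNReal_le_iff_le_coe.2 hu.2))
  exact ((hY.adapted t).aestronglyMeasurable.add h).const_add x

theorem isEquimonotone_V (hc : IsCost c) (hY : IsLevyProcess 𝓕 P Y) (t : ℝ≥0) :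
    IsEquimonotone (V hc hY t) := by
  intro f g z r h x
  refine V_le hc hY _ _ _ fun α hα hfin => ?_
  have hi : ∀ (k : UCb E) y, Integrable (fun ω => k (controlled Y α t y ω)) P := fun k y =>
    k.integrable_comp P (stronglyMeasurable_controlled hY hα t y).aestronglyMeasurable
  have h₁ := le_V hc hY t g x hα hfin
  have h₂ : ∫ ω, f (controlled Y α t (x + z) ω) ∂P ≤
      ∫ ω, (g (controlled Y α t x ω) + r) ∂P := by
    refine integral_mono (hi f _) ((hi g x).add (integrable_const r)) fun ω => ?_
    have := h (controlled Y α t x ω)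
    rwa [controlled, add_right_comm] at this
  rw [integral_add (hi g x) (integrable_const r)] at h₂
  simp only [integral_const, probReal_univ, one_smul] at h₂
  linarith

theorem V_zero (hc : IsCost c) (hY : IsLevyProcess 𝓕 P Y) (f : UCb E) : V hc hY 0 f = f := by
  have hint : ∀ (α : ℝ≥0 → Ω → E) x, ∫ ω, f (controlled Y α 0 x ω) ∂P = f x := fun α x => by
    have : ∫ ω, f (controlled Y α 0 x ω) ∂P = ∫ _, f x ∂P := by
      refine integral_congr_ae ?_
      filter_upwards [hY.zero] with ω hω
      simp [controlled, hω]
    simpa using this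
  have hcost : ∀ α : ℝ≥0 → Ω → E, runningCost c P α 0 = 0 := fun α => by simp [runningCost]
  refine UCb.ext fun x => le_antisymm (V_le hc hY _ _ _ fun α _ _ => ?_) ?_
  · simp [hint, hcost]
  · obtain ⟨α, -⟩ := exists_runningCost_eq_zero hc 𝓕 P 0
    simpa [hint, hcost] using le_V hc hY 0 f x α.2 (by simp [hcost])

theorem Ioc_zero_add (s t : ℝ≥0) :
    Set.Ioc 0 ((s + t : ℝ≥0) : ℝ) = Set.Ioc 0 (s : ℝ) ∪ Set.Ioc (s : ℝ) ((s + t : ℝ≥0) : ℝ) :=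
  (Set.Ioc_union_Ioc_eq_Ioc s.2 (by exact_mod_cast (le_self_add : s ≤ s + t))).symm

theorem disjoint_Ioc_Ioc (s t : ℝ≥0) :
    Disjoint (Set.Ioc 0 (s : ℝ)) (Set.Ioc (s : ℝ) ((s + t : ℝ≥0) : ℝ)) :=
  Set.Ioc_disjoint_Ioc_of_le le_rfl

theorem lintegral_Ioc_add (s t : ℝ≥0) (k : ℝ → ℝ≥0∞) :
    ∫⁻ u in Set.Ioc 0 ((s + t : ℝ≥0) : ℝ), k u = (∫⁻ u in Set.Ioc 0 (s : ℝ), k u) +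
      ∫⁻ u in Set.Ioc (s : ℝ) ((s + t : ℝ≥0) : ℝ), k u := by
  rw [Ioc_zero_add, lintegral_union measurableSet_Ioc (disjoint_Ioc_Ioc s t)]

theorem integral_Ioc_add (s t : ℝ≥0) {k : ℝ → E}
    (hk : IntegrableOn k (Set.Ioc 0 ((s + t : ℝ≥0) : ℝ))) :
    ∫ u in Set.Ioc 0 ((s + t : ℝ≥0) : ℝ), k u = (∫ u in Set.Ioc 0 (s : ℝ), k u) +
      ∫ u in Set.Ioc (s : ℝ) ((s + t : ℝ≥0) : ℝ), k u := by
  rw [Ioc_zero_add] at hk ⊢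
  exact setIntegral_union (disjoint_Ioc_Ioc s t) measurableSet_Ioc hk.left_of_union
    hk.right_of_union

theorem volume_Ioc_add (s t : ℝ≥0) :
    volume (Set.Ioc (s : ℝ) ((s + t : ℝ≥0) : ℝ)) = t := by
  simp [Real.volume_Ioc]

theorem integral_le_toReal_lintegral_ofReal {k : Ω → ℝ} (hk : Integrable k P) :
    ∫ ω, k ω ∂P ≤ (∫⁻ ω, ENNReal.ofReal (k ω) ∂P).toReal := by
  rw [integral_eq_lintegral_pos_part_sub_lintegral_neg_part hk]
  linarith [ENNReal.toReal_nonneg (a := ∫⁻ ω, ENNReal.ofReal (-k ω) ∂P)]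

/-- Anticipating the increment of the noise is advantageous. -/
theorem V_add_le [CompleteSpace E] [TopologicalSpace.SeparableSpace E] [BorelSpace E]
    (hc : IsCost c) (hY : IsLevyProcess 𝓕 P Y) {μ : ℝ≥0 → ProbabilityMeasure E} {t : ℝ≥0}
    (ht : t ≠ 0) (hμ : HasLaw (Y t) (μ t : Measure E) P) (s : ℝ≥0) (f : UCb E) (x : E) :
    V hc hY (s + t) f x ≤ V hc hY s (I hc μ t f) x := by
  have : SecondCountableTopology E := UniformSpace.secondCountable_of_separable E
  refine V_le hc hY _ _ _ fun α hα hfin => ?_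
  -- The noise increment is applied first; what remains on [s, s + t] is a pure drift, to be bounded
  -- path by path.
  set X : Ω → E := fun ω => controlled Y α s x ω + (Y (s + t) ω - Y s ω) with hX
  have hXm : AEStronglyMeasurable X P :=
    (stronglyMeasurable_controlled hY hα s x).aestronglyMeasurable.add
      ((((hY.adapted _).mono (𝓕.le _)).sub ((hY.adapted _).mono (𝓕.le _))).aestronglyMeasurable)
  have hi₁ := f.integrable_comp P
    (stronglyMeasurable_controlled hY hα (s + t) x).aestronglyMeasurable
  have hi₂ := (Φ hc t f).integrable_comp P hXm
  have hpath : ∀ᵐ ω ∂P, ENNReal.ofReal (f (controlled Y α (s + t) x ω) - Φ hc t f (X ω)) ≤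
      ∫⁻ u in Set.Ioc (s : ℝ) ((s + t : ℝ≥0) : ℝ), c (α u.toNNReal ω) := by
    filter_upwards [hα.2.2] with ω hω
    have heq : controlled Y α (s + t) x ω =
        X ω + ∫ u in Set.Ioc (s : ℝ) ((s + t : ℝ≥0) : ℝ), α u.toNNReal ω := by
      simp only [hX, controlled, integral_Ioc_add s t (hω (s + t))]
      abel
    rw [heq]
    refine ofReal_sub_Φ_le_lintegral hc ht f (X ω) ?_ ((hω (s + t)).mono_set ?_)
    · rw [Measure.restrict_apply_univ, volume_Ioc_add]
    · rw [Ioc_zero_add]; exact Set.subset_union_right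
  have hcost : runningCost c P α s +
      ∫⁻ ω, ENNReal.ofReal (f (controlled Y α (s + t) x ω) - Φ hc t f (X ω)) ∂P ≤
      runningCost c P α (s + t) := by
    calc _ ≤ runningCost c P α s +
          ∫⁻ ω, (∫⁻ u in Set.Ioc (s : ℝ) ((s + t : ℝ≥0) : ℝ), c (α u.toNNReal ω)) ∂P := by
          gcongr 1
          exact lintegral_mono_ae hpath
      _ ≤ _ := by
          simp_rw [runningCost, lintegral_Ioc_add s t]
          -- Lower integrals are superadditive, which is the direction needed here.
          exact le_lintegral_add _ _
  have hfin' := ne_top_of_le_ne_top hfin hcost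
  have hfins : runningCost c P α s ≠ ∞ := ne_top_of_le_ne_top hfin' le_self_add
  have h₁ := ENNReal.toReal_mono hfin hcost
  rw [ENNReal.toReal_add hfins (ne_top_of_le_ne_top hfin' le_add_self)] at h₁
  have h₂ := integral_le_toReal_lintegral_ofReal (hi₁.sub hi₂)
  simp only [Pi.sub_apply] at h₂
  -- The Markov property integrates out the increment and turns Φ_t f at X into μ_t Φ_t f at the
  -- state at time s.
  rw [integral_sub hi₁ hi₂, hY.integral_add_increment hμ s (Φ hc t f)
    (aestronglyMeasurable_controlled hY hα s x)] at h₂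
  have h₃ := le_V hc hY s (I hc μ t f) x hα hfins
  simp only [I_eq hc μ ht, Function.comp_apply] at h₃ ⊢
  linarith

end Value

/-! ### Measurable near-optimal velocities -/

section Selection

variable {E : Type*} [NormedAddCommGroup E] [NormedSpace ℝ E]
  [TopologicalSpace.SeparableSpace E] [MeasurableSpace E] [BorelSpace E] {c : E → ℝ≥0∞}

/-- Nearly optimal displacements can be chosen measurably and with countably many values. -/
theorem exists_measurable_selection (hc : IsCost c) (t : ℝ≥0) (f : UCb E) {ε : ℝ} (hε : 0 < ε) :
    ∃ (i : E → ℕ) (b : ℕ → E), Measurable i ∧ (∀ n, c (b n) ≠ ∞) ∧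
      ∀ y, Φ hc t f y - ε ≤ f (y + t • b (i y)) - t * (c (b (i y))).toReal := by
  classical
  have hε3 : 0 < ε / 3 := by positivity
  choose a ha using fun y => exists_lt_Φ hc t f y hε3
  obtain ⟨δ₁, hδ₁, hf⟩ := f.exists_modulus (ε / 3) hε3
  obtain ⟨δ₂, hδ₂, hg⟩ := (Φ hc t f).exists_modulus (ε / 3) hε3
  -- The velocity chosen at a nearby point of a dense sequence is used at y. The three errors are
  -- near-optimality there and the moduli of g ↦ g at f and at Φ_t f.
  have hex : ∀ y : E, ∃ n, dist y (TopologicalSpace.denseSeq E n) < min δ₁ δ₂ := fun y =>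
    (TopologicalSpace.denseRange_denseSeq E).exists_dist_lt y (lt_min hδ₁ hδ₂)
  refine ⟨fun y => Nat.find (hex y), fun n => a (TopologicalSpace.denseSeq E n),
    measurable_find hex fun n => ?_, fun n => (ha _).1, fun y => ?_⟩
  · exact (Metric.isOpen_ball (x := TopologicalSpace.denseSeq E n)).measurableSet
  · have hy := Nat.find_spec (hex y)
    set z := TopologicalSpace.denseSeq E (Nat.find (hex y))
    have h₁ := (abs_le.1 (hf y z (hy.trans_le (min_le_left _ _)) (t • a z))).1
    have h₂ := (abs_le.1 (hg y z (hy.trans_le (min_le_right _ _)) 0)).2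
    simp only [add_zero] at h₂
    have h₃ := (ha z).2
    change Φ hc t f y - ε ≤ f (y + t • a z) - t * (c (a z)).toReal
    linarith

end Selection

/-! ### Feedback controls and dynamic programming -/

section Value

variable {Ω : Type*} {m : MeasurableSpace Ω} {P : Measure Ω} [IsProbabilityMeasure P]
  {E : Type*} [NormedAddCommGroup E] [NormedSpace ℝ E] [MeasurableSpace E]
  {𝓕 : Filtration ℝ≥0 m} {Y : ℝ≥0 → Ω → E} {c : E → ℝ≥0∞}

open scoped Classical in
/-- The control that is `α` up to time `s` and the constant `b` afterwards. -/
noncomputable def switchControl (s : ℝ≥0) (α : ℝ≥0 → Ω → E) (b : Ω → E) : ℝ≥0 → Ω → E :=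
  fun u ω => if u ≤ s then α u ω else b ω

theorem switchControl_of_mem_left {s : ℝ≥0} (α : ℝ≥0 → Ω → E) (b : Ω → E) (ω : Ω) {u : ℝ}
    (hu : u ∈ Set.Ioc 0 (s : ℝ)) : switchControl s α b u.toNNReal ω = α u.toNNReal ω :=
  if_pos (Real.toNNReal_le_iff_le_coe.2 hu.2)

theorem switchControl_of_mem_right {s : ℝ≥0} (α : ℝ≥0 → Ω → E) (b : Ω → E) (ω : Ω) {u r : ℝ}
    (hu : u ∈ Set.Ioc (s : ℝ) r) : switchControl s α b u.toNNReal ω = b ω :=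
  if_neg (by rw [Real.toNNReal_le_iff_le_coe]; exact not_le.2 hu.1)

/-- The new velocity is known at time s and used only later, so adaptedness follows from
monotonicity of the filtration. -/
theorem switchControl_mem {s : ℝ≥0} {α : ℝ≥0 → Ω → E} (hα : α ∈ admissible (E := E) 𝓕 P)
    {b : Ω → E} (hb : StronglyMeasurable[𝓕 s] b) :
    switchControl s α b ∈ admissible (E := E) 𝓕 P := by
  classical
  have hb' := hb.mono (𝓕.le s)
  have hmeas : StronglyMeasurable (Function.uncurry (switchControl s α b)) := by
    have : Function.uncurry (switchControl s α b) = fun p : ℝ≥0 × Ω =>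
        if p.1 ≤ s then Function.uncurry α p else b p.2 := by
      funext p
      simp only [Function.uncurry, switchControl]
    rw [this]
    exact hα.2.1.ite (measurableSet_le measurable_fst measurable_const)
      (hb'.comp_measurable measurable_snd)
  refine ⟨fun u => ?_, hmeas, ?_⟩
  · by_cases hu : u ≤ s
    · have : switchControl s α b u = α u := funext fun ω => if_pos hu
      rw [this]; exact hα.1 u
    · have : switchControl s α b u = b := funext fun ω => if_neg hu
      rw [this]; exact hb.mono (𝓕.mono (not_le.1 hu).le)
  · filter_upwards [hα.2.2] with ω hω t
    have hdom : IntegrableOn (fun u : ℝ => ‖α u.toNNReal ω‖ + ‖b ω‖) (Set.Ioc 0 (t : ℝ)) :=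
      (hω t).norm.add (integrableOn_const (by simp))
    refine Integrable.mono' hdom ?_ (ae_of_all _ fun u => ?_)
    · exact (hmeas.comp_measurable ((measurable_real_toNNReal).prodMk
        measurable_const)).aestronglyMeasurable
    · simp only [switchControl]
      split_ifs
      · linarith [norm_nonneg (b ω)]
      · linarith [norm_nonneg (α u.toNNReal ω)]

/-- Keeping the control constant for a time `t` is possible. -/
theorem V_J_le [CompleteSpace E] [TopologicalSpace.SeparableSpace E] [BorelSpace E]
    (hc : IsCost c) (hY : IsLevyProcess 𝓕 P Y) {μ : ℝ≥0 → ProbabilityMeasure E} {t : ℝ≥0}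
    (ht : t ≠ 0) (hμ : HasLaw (Y t) (μ t : Measure E) P) (s : ℝ≥0) (f : UCb E) (x : E) :
    V hc hY s (J hc μ t f) x ≤ V hc hY (s + t) f x := by
  have : SecondCountableTopology E := UniformSpace.secondCountable_of_separable E
  refine V_le hc hY _ _ _ fun α hα hfin => le_of_forall_pos_le_add fun ε hε => ?_
  set g := transition (μ t) f with hg
  obtain ⟨i, a, hi, ha, hsel⟩ := exists_measurable_selection hc t g hε
  -- Without completeness of 𝓕_s, the feedback must be built from a version of the state.
  obtain ⟨X, hX, hXeq⟩ := aestronglyMeasurable_controlled hY hα s x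
  set b : Ω → E := fun ω => a (i (X ω)) with hb_def
  have hiX : Measurable[𝓕 s] fun ω => i (X ω) := hi.comp hX.measurable
  have hb : StronglyMeasurable[𝓕 s] b :=
    ((measurable_from_nat (f := a)).comp hiX).stronglyMeasurable
  -- Countably many values make this measurable even if `c` is not.
  have hcb : Measurable fun ω => c (b ω) :=
    (measurable_from_nat (f := fun n => c (a n))).comp (hiX.mono (𝓕.le s) le_rfl)
  set β := switchControl s α b with hβ_def
  have hβ : β ∈ admissible (E := E) 𝓕 P := switchControl_mem hα hb
  have hcontrolled : ∀ᵐ ω ∂P, controlled Y β (s + t) x ω =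
      (X ω + t • b ω) + (Y (s + t) ω - Y s ω) := by
    filter_upwards [hβ.2.2, hXeq] with ω hω hω'
    have h₁ : ∫ u in Set.Ioc 0 (s : ℝ), β u.toNNReal ω =
        ∫ u in Set.Ioc 0 (s : ℝ), α u.toNNReal ω :=
      setIntegral_congr_fun measurableSet_Ioc fun u hu => switchControl_of_mem_left α b ω hu
    have h₂ : ∫ u in Set.Ioc (s : ℝ) ((s + t : ℝ≥0) : ℝ), β u.toNNReal ω = t • b ω := by
      rw [setIntegral_congr_fun measurableSet_Ioc fun u hu => switchControl_of_mem_right α b ω hu,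
        setIntegral_const, measureReal_def, volume_Ioc_add]
      rfl
    rw [← hω', controlled, controlled, integral_Ioc_add s t (hω (s + t)), h₁, h₂]
    abel
  have hcost : runningCost c P β (s + t) =
      runningCost c P α s + ∫⁻ ω, t * c (b ω) ∂P := by
    have hin : ∀ ω, ∫⁻ u in Set.Ioc 0 ((s + t : ℝ≥0) : ℝ), c (β u.toNNReal ω) =
        (∫⁻ u in Set.Ioc 0 (s : ℝ), c (α u.toNNReal ω)) + t * c (b ω) := fun ω => by
      have h₁ : ∫⁻ u in Set.Ioc 0 (s : ℝ), c (β u.toNNReal ω) =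
          ∫⁻ u in Set.Ioc 0 (s : ℝ), c (α u.toNNReal ω) :=
        setLIntegral_congr_fun measurableSet_Ioc fun u hu =>
          congrArg c (switchControl_of_mem_left α b ω hu)
      have h₂ : ∫⁻ u in Set.Ioc (s : ℝ) ((s + t : ℝ≥0) : ℝ), c (β u.toNNReal ω) =
          ∫⁻ _ in Set.Ioc (s : ℝ) ((s + t : ℝ≥0) : ℝ), c (b ω) :=
        setLIntegral_congr_fun measurableSet_Ioc fun u hu =>
          congrArg c (switchControl_of_mem_right α b ω hu)
      rw [lintegral_Ioc_add s t, h₁, h₂, setLIntegral_const, volume_Ioc_add, mul_comm]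
    simp_rw [runningCost, hin]
    -- Additivity of the lower integral needs only one measurable summand; the cost of α may fail to
    -- be measurable.
    exact lintegral_add_right _ (hcb.const_mul _)
  -- Near-optimality caps the cost, since standing still already achieves at least -‖g‖.
  have hbound : ∀ ω, t * (c (b ω)).toReal ≤ 2 * ‖g.1‖ + ε := fun ω => by
    have h₁ := hsel (X ω)
    have h₂ := self_le_Φ hc t g (X ω)
    have h₃ := (abs_le.1 (g.abs_le (X ω))).1
    have h₄ := (abs_le.1 (g.abs_le (X ω + t • a (i (X ω))))).2
    linarith
  have hm : Measurable fun ω => (t : ℝ) * (c (b ω)).toReal := hcb.ennreal_toReal.const_mul _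
  have hint : Integrable (fun ω => (t : ℝ) * (c (b ω)).toReal) P :=
    Integrable.of_bound hm.aestronglyMeasurable (2 * ‖g.1‖ + ε) (ae_of_all _ fun ω => by
      rw [Real.norm_of_nonneg (mul_nonneg t.coe_nonneg ENNReal.toReal_nonneg)]
      exact hbound ω)
  have hlint : ∫⁻ ω, t * c (b ω) ∂P =
      ENNReal.ofReal (∫ ω, t * (c (b ω)).toReal ∂P) := by
    rw [ofReal_integral_eq_lintegral_ofReal hint
      (ae_of_all _ fun ω => mul_nonneg t.coe_nonneg ENNReal.toReal_nonneg)]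
    refine lintegral_congr fun ω => ?_
    rw [ENNReal.ofReal_mul t.coe_nonneg, ENNReal.ofReal_toReal (ha _), ENNReal.ofReal_coe_nnreal]
  have hfin' : runningCost c P β (s + t) ≠ ∞ := by
    rw [hcost, hlint]
    finiteness
  have hcost' : (runningCost c P β (s + t)).toReal =
      (runningCost c P α s).toReal + ∫ ω, t * (c (b ω)).toReal ∂P := by
    rw [hcost, hlint, ENNReal.toReal_add hfin ENNReal.ofReal_ne_top, ENNReal.toReal_ofReal
      (integral_nonneg fun ω => mul_nonneg t.coe_nonneg ENNReal.toReal_nonneg)]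
  have hXm : AEStronglyMeasurable X P := (hX.mono (𝓕.le s)).aestronglyMeasurable
  have hXb : StronglyMeasurable[𝓕 s] fun ω => X ω + t • b ω := hX.add (hb.const_smul t)
  have h₁ : ∫ ω, f (controlled Y β (s + t) x ω) ∂P = ∫ ω, g (X ω + t • b ω) ∂P := by
    rw [hg, ← hY.integral_add_increment hμ s f hXb.aestronglyMeasurable]
    refine integral_congr_ae ?_
    filter_upwards [hcontrolled] with ω hω
    rw [hω]
  have h₂ : ∫ ω, J hc μ t f (controlled Y α s x ω) ∂P = ∫ ω, Φ hc t g (X ω) ∂P := by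
    refine integral_congr_ae ?_
    filter_upwards [hXeq] with ω hω
    rw [hω, J_eq hc μ ht, Function.comp_apply]
  have hi₁ := (Φ hc t g).integrable_comp P hXm
  have hi₂ := g.integrable_comp P (hXb.mono (𝓕.le s)).aestronglyMeasurable
  have h₃ : ∫ ω, (Φ hc t g (X ω) - ε) ∂P ≤
      ∫ ω, (g (X ω + t • b ω) - t * (c (b ω)).toReal) ∂P :=
    integral_mono (hi₁.sub (integrable_const ε)) (hi₂.sub hint) fun ω => hsel (X ω)
  rw [integral_sub hi₁ (integrable_const ε), integral_sub hi₂ hint] at h₃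
  simp only [integral_const, probReal_univ, one_smul] at h₃
  have h₄ := le_V hc hY (s + t) f x hβ hfin'
  rw [h₂]
  linarith

/-- The last time step is peeled off first. The leading time s is kept general because both s = 0
and s > 0 are needed for the same iterate. -/
theorem V_add_nsmul_le [CompleteSpace E] [TopologicalSpace.SeparableSpace E] [BorelSpace E]
    (hc : IsCost c) (hY : IsLevyProcess 𝓕 P Y) {μ : ℝ≥0 → ProbabilityMeasure E} {h : ℝ≥0}
    (hh : h ≠ 0) (hμ : HasLaw (Y h) (μ h : Measure E) P) (s : ℝ≥0) (n : ℕ) (f : UCb E) (x : E) :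
    V hc hY (s + n • h) f x ≤ V hc hY s ((I hc μ h)^[n] f) x := by
  induction n generalizing f with
  | zero => simp
  | succ n ih =>
    rw [succ_nsmul, ← add_assoc, Function.iterate_succ_apply]
    exact (V_add_le hc hY hh hμ _ f x).trans (ih _)

theorem V_iterate_J_le [CompleteSpace E] [TopologicalSpace.SeparableSpace E] [BorelSpace E]
    (hc : IsCost c) (hY : IsLevyProcess 𝓕 P Y) {μ : ℝ≥0 → ProbabilityMeasure E} {h : ℝ≥0}
    (hh : h ≠ 0) (hμ : HasLaw (Y h) (μ h : Measure E) P) (s : ℝ≥0) (n : ℕ) (f : UCb E) (x : E) :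
    V hc hY s ((J hc μ h)^[n] f) x ≤ V hc hY (s + n • h) f x := by
  induction n generalizing f with
  | zero => simp
  | succ n ih =>
    rw [succ_nsmul, ← add_assoc, Function.iterate_succ_apply]
    exact (ih _).trans (V_J_le hc hY hh hμ _ f x)

/-- The dynamic programming principle. -/
theorem V_add [CompleteSpace E] [TopologicalSpace.SeparableSpace E] [BorelSpace E]
    (hc : IsCost c) (hY : IsLevyProcess 𝓕 P Y) {μ : ℝ≥0 → ProbabilityMeasure E}
    (hμ : ∀ t, 0 < t → HasLaw (Y t) (μ t : Measure E) P) (s t : ℝ≥0) (f : UCb E) :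
    V hc hY (s + t) f = V hc hY s (V hc hY t f) := by
  rcases eq_or_ne t 0 with rfl | ht
  · rw [add_zero, V_zero]
  -- G and H are iterates of I and J on f with total time t; the same pair must work for every r.
  have key : ∀ ε > 0, ∃ G H : UCb E, (∀ x, G x ≤ H x + ε) ∧
      (∀ r x, V hc hY r H x ≤ V hc hY (r + t) f x) ∧
      ∀ r x, V hc hY (r + t) f x ≤ V hc hY r G x := fun ε hε => by
    -- The interval is cut into n + 1 equal steps, so the step is positive for every n.
    have hlim : Tendsto (fun n : ℕ => t / (n + 1)) atTop (𝓝[>] 0) := by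
      refine tendsto_nhdsWithin_iff.2 ⟨?_, Eventually.of_forall fun n =>
        div_pos (pos_iff_ne_zero.2 ht) (by positivity)⟩
      simpa [div_eq_mul_inv] using
        (tendsto_one_div_add_atTop_nhds_zero_nat (𝕜 := ℝ≥0)).const_mul t
    obtain ⟨n, hn⟩ := (hlim.eventually (hY.exists_iterate_I_le hc hμ f hε)).exists
    have hpos : 0 < t / (n + 1) := div_pos (pos_iff_ne_zero.2 ht) (by positivity)
    have hmul : (n + 1) • (t / (n + 1)) = t := by
      rw [nsmul_eq_mul]
      push_cast
      exact mul_div_cancel₀ _ (by positivity)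
    refine ⟨_, _, hn (n + 1), fun r x => ?_, fun r x => ?_⟩
    · simpa only [hmul] using V_iterate_J_le hc hY hpos.ne' (hμ _ hpos) r (n + 1) f x
    · simpa only [hmul] using V_add_nsmul_le hc hY hpos.ne' (hμ _ hpos) r (n + 1) f x
  have hmono := isEquimonotone_V hc hY s
  refine UCb.ext fun x => le_antisymm ?_ ?_ <;> refine le_of_forall_pos_le_add fun ε hε => ?_
  -- Time r = 0 gives H ≤ V_t f ≤ G, and r = s bounds V_{s+t} f by V_s H and V_s G, which differ by
  -- at most ε.
  all_goals
    obtain ⟨G, H, hGH, hH, hG⟩ := key ε hε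
    have h₁ := hmono.le_add hGH x
    have hHt : ∀ y, H y ≤ V hc hY t f y := fun y => by simpa [V_zero] using hH 0 y
    have hGt : ∀ y, V hc hY t f y ≤ G y := fun y => by simpa [V_zero] using hG 0 y
  · linarith [hmono.mono hHt x, hG s x]
  · linarith [hmono.mono hGt x, hH s x]

end Value

/-! ### Inequalities for I and J -/

section Compositions

variable {Ω : Type*} {m : MeasurableSpace Ω} {P : Measure Ω} [IsProbabilityMeasure P]
  {E : Type*} [NormedAddCommGroup E] [NormedSpace ℝ E] [TopologicalSpace.SeparableSpace E]
  [MeasurableSpace E] [BorelSpace E] {𝓕 : Filtration ℝ≥0 m} {Y : ℝ≥0 → Ω → E} {c : E → ℝ≥0∞}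

/-- Exchange the middle factors: Φ_s Φ_t μ_s μ_t f ≤ Φ_s μ_s Φ_t μ_t f. -/
theorem J_add_le (hc : IsCost c) (hY : IsLevyProcess 𝓕 P Y) {μ : ℝ≥0 → ProbabilityMeasure E}
    (hμ : ∀ t, 0 < t → HasLaw (Y t) (μ t : Measure E) P) (s t : ℝ≥0) (f : UCb E) :
    J hc μ (s + t) f ≤ J hc μ s (J hc μ t f) := by
  rcases eq_or_ne s 0 with rfl | hs
  · simp [J]
  rcases eq_or_ne t 0 with rfl | ht
  · simp [J]
  have hst : s + t ≠ 0 := by positivity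
  rw [J_eq hc μ hs, J_eq hc μ ht, J_eq hc μ hst]
  simp only [Function.comp_apply]
  rw [Φ_add, hY.transition_add (hμ s hs.pos) (hμ t ht.pos) (hμ _ hst.pos)]
  exact fun x => (isEquimonotone_Φ hc s).mono (fun y => Φ_transition_le hc t (μ s) _ y) x

/-- Exchange the middle factors: μ_s Φ_s μ_t Φ_t f ≤ μ_s μ_t Φ_s Φ_t f. -/
theorem I_I_le (hc : IsCost c) (hY : IsLevyProcess 𝓕 P Y) {μ : ℝ≥0 → ProbabilityMeasure E}
    (hμ : ∀ t, 0 < t → HasLaw (Y t) (μ t : Measure E) P) (s t : ℝ≥0) (f : UCb E) :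
    I hc μ s (I hc μ t f) ≤ I hc μ (s + t) f := by
  rcases eq_or_ne s 0 with rfl | hs
  · simp [I]
  rcases eq_or_ne t 0 with rfl | ht
  · simp [I]
  have hst : s + t ≠ 0 := by positivity
  rw [I_eq hc μ hs, I_eq hc μ ht, I_eq hc μ hst]
  simp only [Function.comp_apply]
  rw [Φ_add, hY.transition_add (hμ s hs.pos) (hμ t ht.pos) (hμ _ hst.pos)]
  exact fun x => (isEquimonotone_transition (μ s)).mono
    (fun y => Φ_transition_le hc s (μ t) _ y) x

end Compositions

end HopfLax

theorem mainTheorem2 {E : Type*} [NormedAddCommGroup E] [NormedSpace ℝ E] [CompleteSpace E]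
    [TopologicalSpace.SeparableSpace E] [MeasurableSpace E] [BorelSpace E]
    {c : E → ℝ≥0∞} (hc : HopfLax.IsCost c)
    {Ω : Type*} {m : MeasurableSpace Ω} {P : Measure Ω} [IsProbabilityMeasure P]
    {𝓕 : Filtration ℝ≥0 m} {Y : ℝ≥0 → Ω → E} (hY : HopfLax.IsLevyProcess 𝓕 P Y)
    (μ : ℝ≥0 → ProbabilityMeasure E) (hμ : ∀ t, 0 < t → HasLaw (Y t) (μ t : Measure E) P)
    (s t : ℝ≥0) (f : HopfLax.UCb E) :
    HopfLax.Φ hc (s + t) f = HopfLax.Φ hc s (HopfLax.Φ hc t f) ∧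
      HopfLax.J hc μ (s + t) f ≤ HopfLax.J hc μ s (HopfLax.J hc μ t f) ∧
      HopfLax.I hc μ s (HopfLax.I hc μ t f) ≤ HopfLax.I hc μ (s + t) f ∧
      HopfLax.V hc hY (s + t) f = HopfLax.V hc hY s (HopfLax.V hc hY t f) := by
  exact ⟨HopfLax.Φ_add hc s t f, HopfLax.J_add_le hc hY hμ s t f, HopfLax.I_I_le hc hY hμ s t f,
    HopfLax.V_add hc hY hμ s t f⟩
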